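/- Let $G=(V,E)$ be a finite connected simple graph and let $\gamma:(0,\infty)\to(0,\infty)$ be Lipschitz on $[\delta,M]$ for all $0<\delta<M$. For edge weights $w$ on a graph on $V$, let $d(x,y)$ be the least total weight of a path from $x$ to $y$. For $\alpha\in[0,1]$ let $\mu_x^\alpha$ be the distribution with $\mu_x^\alpha(x)=\alpha$, $\mu_x^\alpha(y)=(1-\alpha)\gamma(w_{xy})/\sum_{z\sim x}\gamma(w_{xz})$ for $y\sim x$, and $\mu_x^\alpha(y)=0$ otherwise. Let $W$ be the transportation distance with cost $d$, let $\kappa_\alpha(x,y)=1-W(\mu_x^\alpha,\mu_y^\alpha)/d(x,y)$, and let $\kappa(x,y)=\lim_{\alpha\to1^-}\kappa_\alpha(x,y)/(1-\alpha)$ be the Ollivier–Lin–Lu–Yau curvature. The unnormalized Ricci flow is the system $$\frac{dw_e}{dt}=-\kappa_e w_e\qquad(e\in E),$$ where $\kappa_e=\kappa(x,y)$ for $e=xy$; the existence of the limits $\kappa_e$ is part of being a solution, and solutions take values in $[0,\infty)^E$. The exit condition (I) is: $w_{uv}(t)>d(u,v)(t)$ for some edge $uv$ and some time $t$. The flow with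 exit condition (I) starts at time $0$ on $G$ with given weights and runs as follows. If the solution on the current graph never meets (I), it is followed for all later times. Otherwise let $T$ be the infimum of the times at which the solution on the current graph (continued slightly beyond $T$) meets (I), and let $S$ be the nonempty set of edges $uv$ for which $T$ is the infimum of the times with $w_{uv}>d(u,v)$. The solution is followed on $[\,\cdot\,,T)$; at time $T$ a nonempty subset of $S$, chosen by a fixed rule from $S$ (for example all of $S$, or one edge of it), is deleted, and the flow is restarted at time $T$ on the remaining graph from the current weights of the remaining edges. Then, for every choice of initial weights $w_e(0)>0$, $e\in E$: 1. For every selection rule, the flow with exit condition (I) has exactly one solution, and it is defined for all $t\in[0,\infty)$: there are graphs $G(t)$ and weights $w(t)$ on the edges of $G(t)$, $t\ge 0$, with finitely many deletions, that follow the flow, and they are unique. All weights $w_e(t)$ of edges of $G(t)$ are positive. 2. In particular, if no solution on $G$ with these initial weights on any interval $[0,b)$, $b>0$, meets (I), so that each edge is always a shortest path between its ends, then the system $dw_e/dt=-\kappa_e w_e$ on $G$ has exactly one solution on $[0,\infty)$ with these initial weights, and its weights are positive for all time. -/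

import Mathlib

/-!
If `μ x + ν y ≥ 1`, every coupling of `t μ + (1 - t) δ_x` with `t ν + (1 - t) δ_y` moves mass at
least `1 - t` from `x` to `y`; splitting this mass off shows that the transportation cost is affine
in `t`. Hence `κ_α / (1 - α)` is constant for `α ≥ 1/2`, and the curvature exists and equals
`2 κ_{1/2}`. This expression is locally Lipschitz in positive weights, so the theorem of
Picard and Lindelöf gives local existence and uniqueness. As `κ ≤ 2`, a weight decays at most like
`e^{-2t}` and stays positive. As long as no edge exits, the weight of an edge is the distance of
its ends, so the field is bounded by a multiple of the weights and there is no blow-up.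
Each exit deletes an edge, so there are finitely many restarts.
-/

open Set Filter Topology

namespace RicciFlow

noncomputable section

variable {V : Type*} [Fintype V]

/-- The weighted distance `d(x, y)`: the least total weight of a path of `H` from `x` to `y`.
A weight function is a function on unordered pairs; only its values on edges of `H` matter. -/
def wdist (H : SimpleGraph V) (w : Sym2 V → ℝ) (x y : V) : ℝ :=
  ⨅ p : H.Path x y, (p.1.edges.map w).sum

open Classical in
/-- The lazy random walk distribution `μ_x^α`. -/
def lazyWalk (γ : ℝ → ℝ) (H : SimpleGraph V) (w : Sym2 V → ℝ) (α : ℝ) (x y : V) : ℝ :=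
  if y = x then α
  else if H.Adj x y then
    (1 - α) * (γ (w s(x, y)) / ∑ z with H.Adj x z, γ (w s(x, z)))
  else 0

/-- `A` is a coupling of the distributions `μ₁` and `μ₂`. -/
def IsCoupling (μ₁ μ₂ : V → ℝ) (A : V → V → ℝ) : Prop :=
  (∀ x y, A x y ∈ Icc (0 : ℝ) 1) ∧ (∀ x, ∑ y, A x y = μ₁ x) ∧ (∀ y, ∑ x, A x y = μ₂ y)

/-- The transportation distance between `μ₁` and `μ₂` with respect to the cost `d`. -/
def transport (d : V → V → ℝ) (μ₁ μ₂ : V → ℝ) : ℝ :=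
  sInf {c : ℝ | ∃ A, IsCoupling μ₁ μ₂ A ∧ c = ∑ x, ∑ y, A x y * d x y}

/-- The `α`-Ricci curvature `κ_α(x, y)`. -/
def alphaCurvature (γ : ℝ → ℝ) (H : SimpleGraph V) (w : Sym2 V → ℝ) (α : ℝ) (x y : V) : ℝ :=
  1 - transport (wdist H w) (lazyWalk γ H w α x) (lazyWalk γ H w α y) / wdist H w x y

/-- The Ollivier-Lin-Lu-Yau curvature `κ(x, y) = lim_{α → 1} κ_α(x, y) / (1 - α)` exists and
equals `k`. -/
def HasRicciCurvature (γ : ℝ → ℝ) (H : SimpleGraph V) (w : Sym2 V → ℝ) (x y : V) (k : ℝ) :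
    Prop :=
  Tendsto (fun α : ℝ => alphaCurvature γ H w α x y / (1 - α)) (𝓝[<] 1) (𝓝 k)

/-- `X` solves the unnormalized Ricci flow `dw_e/dt = -κ_e w_e` on the graph `H` over the time
interval `I`: the weights are nonnegative and, for every edge, the curvature exists and the
equation holds (with a one-sided derivative at an end point of `I`). -/
def IsSolutionOn (γ : ℝ → ℝ) (H : SimpleGraph V) (X : ℝ → Sym2 V → ℝ) (I : Set ℝ) : Prop :=
  ∀ t ∈ I, (∀ e ∈ H.edgeSet, 0 ≤ X t e) ∧
    ∀ x y, H.Adj x y → ∃ k, HasRicciCurvature γ H (X t) x y k ∧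
      HasDerivWithinAt (fun τ => X τ s(x, y)) (-k * X t s(x, y)) I t

/-- The edges `uv` of `H` with `w_{uv} > d(u, v)`. The exit condition is met when there is one. -/
def exceedingEdges (H : SimpleGraph V) (w : Sym2 V → ℝ) : Set (Sym2 V) :=
  {e | ∃ u v, H.Adj u v ∧ e = s(u, v) ∧ wdist H w u v < w s(u, v)}

/-- The edges of `H` that start to exceed the distance between their ends at the time `T`, when
`X` is followed over the time interval `I`. -/
def exitingEdges (H : SimpleGraph V) (X : ℝ → Sym2 V → ℝ) (I : Set ℝ) (T : ℝ) : Set (Sym2 V) :=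
  {e | IsGLB {t ∈ I | e ∈ exceedingEdges H (X t)} T}

/-- `sel` picks at least one edge out of every nonempty set of edges. -/
def IsSelectionRule (sel : Set (Sym2 V) → Set (Sym2 V)) : Prop :=
  ∀ S : Set (Sym2 V), S.Nonempty → (sel S).Nonempty ∧ sel S ⊆ S

/-- `IsFlow γ sel H s w₀ K Y`: on the time interval `[s, ∞)`, the graphs `K t` with the weights
`Y t` follow the unnormalized Ricci flow with the exit condition, started at time `s` from the
graph `H` with the weights `w₀`.

Either the exit condition is never met, and `Y` is a solution on `H` for all times `t ≥ s`; or the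
solution `X` on `H` meets it, first at time `T`: then the flow is `X` before `T`, the edges that
`sel` picks among those exiting at `T` are deleted, and the flow is restarted at time `T` from the
remaining graph with its current weights. -/
inductive IsFlow (γ : ℝ → ℝ) (sel : Set (Sym2 V) → Set (Sym2 V)) :
    SimpleGraph V → ℝ → (Sym2 V → ℝ) → (ℝ → SimpleGraph V) → (ℝ → Sym2 V → ℝ) → Prop
  | noExit {H : SimpleGraph V} {s : ℝ} {w₀ : Sym2 V → ℝ}
      {K : ℝ → SimpleGraph V} {Y : ℝ → Sym2 V → ℝ}
      (hY : IsSolutionOn γ H Y (Ici s))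
      (hinit : ∀ e ∈ H.edgeSet, Y s e = w₀ e)
      (hno : ∀ t, s ≤ t → exceedingEdges H (Y t) = ∅)
      (hK : ∀ t, s ≤ t → K t = H) :
      IsFlow γ sel H s w₀ K Y
  | exit {H : SimpleGraph V} {s : ℝ} {w₀ : Sym2 V → ℝ}
      {K : ℝ → SimpleGraph V} {Y : ℝ → Sym2 V → ℝ}
      (X : ℝ → Sym2 V → ℝ) (b T : ℝ)
      (hX : IsSolutionOn γ H X (Ico s b))
      (hinit : ∀ e ∈ H.edgeSet, X s e = w₀ e)
      (hT : IsGLB {t ∈ Ico s b | (exceedingEdges H (X t)).Nonempty} T)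
      (hK : ∀ t ∈ Ico s T, K t = H)
      (hYX : ∀ t ∈ Ico s T, ∀ e ∈ H.edgeSet, Y t e = X t e)
      (hrest : IsFlow γ sel (H.deleteEdges (sel (exitingEdges H X (Ico s b) T))) T (X T) K Y) :
      IsFlow γ sel H s w₀ K Y

end

end RicciFlow

namespace RicciFlow

open scoped NNReal

section Transport

variable {V : Type*} [Fintype V] {d d' : V → V → ℝ} {μ ν μ' ν' : V → ℝ} {A B : V → V → ℝ}
  {D ε η a b t : ℝ} {x y : V}

/-- The cost of the transport plan `A`, which moves the mass `A x y` from `x` to `y` at the price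
`d x y` per unit. -/
noncomputable def planCost (d A : V → V → ℝ) : ℝ :=
  ∑ x, ∑ y, A x y * d x y

lemma planCost_add (d A B : V → V → ℝ) : planCost d (A + B) = planCost d A + planCost d B := by
  simp only [planCost, Pi.add_apply, add_mul, Finset.sum_add_distrib]

lemma planCost_smul (d : V → V → ℝ) (a : ℝ) (A : V → V → ℝ) :
    planCost d (a • A) = a * planCost d A := by
  simp only [planCost, Pi.smul_apply, smul_eq_mul, mul_assoc, Finset.mul_sum]

lemma planCost_single [DecidableEq V] (d : V → V → ℝ) (x y : V) :
    planCost d (Pi.single x (Pi.single y 1)) = d x y := by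
  rw [planCost, Finset.sum_eq_single_of_mem x (Finset.mem_univ x)
    fun u _ hu => by simp [Pi.single_eq_of_ne hu]]
  simp [Pi.single_apply]

lemma continuous_planCost (d : V → V → ℝ) : Continuous (planCost d) := by
  unfold planCost
  fun_prop

lemma transport_eq_sInf_image (d : V → V → ℝ) (μ ν : V → ℝ) :
    transport d μ ν = sInf (planCost d '' {A | IsCoupling μ ν A}) := by
  simp only [transport, planCost, image, mem_ofPred_eq, eq_comm]

lemma isCompact_setOf_isCoupling (μ ν : V → ℝ) : IsCompact {A | IsCoupling μ ν A} := by
  refine (isCompact_univ_pi fun _ => isCompact_univ_pi fun _ =>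
    isCompact_Icc (a := (0 : ℝ)) (b := 1)).of_isClosed_subset ?_
    fun A hA x _ y _ => hA.1 x y
  simp only [IsCoupling, ofPred_and, ofPred_forall]
  refine (isClosed_iInter fun x => isClosed_iInter fun y => ?_).inter
    ((isClosed_iInter fun x => ?_).inter (isClosed_iInter fun y => ?_))
  · exact isClosed_Icc.preimage (by fun_prop)
  · exact isClosed_eq (by fun_prop) continuous_const
  · exact isClosed_eq (by fun_prop) continuous_const

lemma transport_le_planCost (d : V → V → ℝ) (hA : IsCoupling μ ν A) :
    transport d μ ν ≤ planCost d A := by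
  rw [transport_eq_sInf_image]
  exact csInf_le ((isCompact_setOf_isCoupling μ ν).image (continuous_planCost d)).bddBelow
    (mem_image_of_mem _ hA)

lemma isCoupling_of_nonneg (hμ : μ ∈ stdSimplex ℝ V) (hA : ∀ x y, 0 ≤ A x y)
    (hrow : ∀ x, ∑ y, A x y = μ x) (hcol : ∀ y, ∑ x, A x y = ν y) : IsCoupling μ ν A := by
  refine ⟨fun x y => ⟨hA x y, ?_⟩, hrow, hcol⟩
  calc A x y ≤ ∑ y, A x y := Finset.single_le_sum (fun z _ => hA x z) (Finset.mem_univ y)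
    _ = μ x := hrow x
    _ ≤ 1 := (mem_Icc_of_mem_stdSimplex hμ x).2

lemma isCoupling_mul (hμ : μ ∈ stdSimplex ℝ V) (hν : ν ∈ stdSimplex ℝ V) :
    IsCoupling μ ν fun x y => μ x * ν y :=
  isCoupling_of_nonneg hμ (fun x y => mul_nonneg (hμ.1 x) (hν.1 y))
    (fun x => by rw [← Finset.mul_sum, hν.2, mul_one])
    fun y => by rw [← Finset.sum_mul, hμ.2, one_mul]

lemma isCoupling_single [DecidableEq V] (x y : V) :
    IsCoupling (Pi.single x 1) (Pi.single y 1) (Pi.single x (Pi.single y 1)) := by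
  refine isCoupling_of_nonneg (single_mem_stdSimplex ℝ x) (fun u v => ?_) (fun u => ?_)
    fun v => ?_
  · by_cases hu : u = x <;> by_cases hv : v = y <;> simp [hu, hv]
  · by_cases hu : u = x <;> simp [Pi.single_apply, hu]
  · rw [← Finset.sum_apply, Finset.sum_pi_single']
    simp

lemma IsCoupling.add_smul (hA : IsCoupling μ ν A) (hB : IsCoupling μ' ν' B) (ha : 0 ≤ a)
    (hb : 0 ≤ b) (hab : a + b = 1) :
    IsCoupling (a • μ + b • μ') (a • ν + b • ν') (a • A + b • B) := by
  refine ⟨fun x y => convex_Icc 0 1 (hA.1 x y) (hB.1 x y) ha hb hab, fun x => ?_, fun y => ?_⟩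
  · simp [Finset.sum_add_distrib, ← Finset.mul_sum, hA.2.1, hB.2.1]
  · simp [Finset.sum_add_distrib, ← Finset.mul_sum, hA.2.2, hB.2.2]

lemma IsCoupling.sum_eq_one (hμ : μ ∈ stdSimplex ℝ V) (hA : IsCoupling μ ν A) :
    ∑ x, ∑ y, A x y = 1 := by
  simp only [hA.2.1, hμ.2]

lemma exists_isCoupling_planCost_eq (d : V → V → ℝ) (hμ : μ ∈ stdSimplex ℝ V)
    (hν : ν ∈ stdSimplex ℝ V) : ∃ A, IsCoupling μ ν A ∧ planCost d A = transport d μ ν := by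
  rw [transport_eq_sInf_image]
  exact ((isCompact_setOf_isCoupling μ ν).image (continuous_planCost d)).sInf_mem
    (Nonempty.image _ ⟨_, isCoupling_mul hμ hν⟩)

lemma transport_nonneg (hd : ∀ x y, 0 ≤ d x y) (μ ν : V → ℝ) : 0 ≤ transport d μ ν :=
  Real.sInf_nonneg fun _ ⟨_, hA, hc⟩ => hc ▸
    Finset.sum_nonneg fun x _ => Finset.sum_nonneg fun y _ => mul_nonneg (hA.1 x y).1 (hd x y)

lemma transport_swap (d : V → V → ℝ) (μ ν : V → ℝ) :
    transport (Function.swap d) ν μ = transport d μ ν := by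
  refine congrArg sInf (ext fun c => ⟨?_, ?_⟩) <;> rintro ⟨A, hA, rfl⟩ <;>
    exact ⟨Function.swap A, ⟨fun x y => hA.1 y x, hA.2.2, hA.2.1⟩, Finset.sum_comm⟩

lemma transport_le_add (h : ∀ x y, d x y ≤ d' x y + η) (hμ : μ ∈ stdSimplex ℝ V)
    (hν : ν ∈ stdSimplex ℝ V) : transport d μ ν ≤ transport d' μ ν + η := by
  obtain ⟨A, hA, hcost⟩ := exists_isCoupling_planCost_eq d' hμ hν
  calc transport d μ ν ≤ planCost d A := transport_le_planCost d hA
    _ ≤ ∑ x, ∑ y, A x y * (d' x y + η) :=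
        Finset.sum_le_sum fun x _ => Finset.sum_le_sum fun y _ =>
          mul_le_mul_of_nonneg_left (h x y) (hA.1 x y).1
    _ = planCost d' A + (∑ x, ∑ y, A x y) * η := by
        simp only [planCost, mul_add, Finset.sum_add_distrib, Finset.sum_mul]
    _ = transport d' μ ν + η := by rw [hA.sum_eq_one hμ, one_mul, hcost]

lemma transport_le (hd : ∀ x y, d x y ≤ D) (hμ : μ ∈ stdSimplex ℝ V) (hν : ν ∈ stdSimplex ℝ V) :
    transport d μ ν ≤ D := by
  have hzero : transport 0 μ ν ≤ 0 :=
    (transport_le_planCost 0 (isCoupling_mul hμ hν)).trans_eq (by simp [planCost])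
  linarith [transport_le_add (d' := 0) (η := D) (by simpa using hd) hμ hν]

lemma transport_add_smul_le (d : V → V → ℝ) (hμ : μ ∈ stdSimplex ℝ V) (hν : ν ∈ stdSimplex ℝ V)
    (hμ' : μ' ∈ stdSimplex ℝ V) (hν' : ν' ∈ stdSimplex ℝ V) (ha : 0 ≤ a) (hb : 0 ≤ b)
    (hab : a + b = 1) :
    transport d (a • μ + b • μ') (a • ν + b • ν') ≤
      a * transport d μ ν + b * transport d μ' ν' := by
  obtain ⟨A, hA, hcostA⟩ := exists_isCoupling_planCost_eq d hμ hν
  obtain ⟨B, hB, hcostB⟩ := exists_isCoupling_planCost_eq d hμ' hν'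
  refine (transport_le_planCost d (hA.add_smul hB ha hb hab)).trans_eq ?_
  rw [planCost_add, planCost_smul, planCost_smul, hcostA, hcostB]

lemma exists_eq_add_smul_of_smul_le (hμ : μ ∈ stdSimplex ℝ V) (hμ' : μ' ∈ stdSimplex ℝ V)
    (hε : 0 ≤ ε) (h : (1 - ε) • μ ≤ μ') :
    ∃ ρ ∈ stdSimplex ℝ V, (1 - ε) • μ + ε • ρ = μ' := by
  rcases hε.eq_or_lt with rfl | hε
  · have hle : ∀ x ∈ Finset.univ, μ x ≤ μ' x := fun x _ => by simpa using h x
    have heq := (Finset.sum_eq_sum_iff_of_le hle).1 (hμ.2.trans hμ'.2.symm)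
    exact ⟨μ, hμ, by simpa using funext fun x => heq x (Finset.mem_univ x)⟩
  · refine ⟨ε⁻¹ • (μ' - (1 - ε) • μ), ⟨fun x => ?_, ?_⟩, ?_⟩
    · exact mul_nonneg (inv_nonneg.2 hε.le) (sub_nonneg.2 (h x))
    · simp only [Pi.smul_apply, Pi.sub_apply, smul_eq_mul, ← Finset.mul_sum,
        Finset.sum_sub_distrib, hμ.2, hμ'.2]
      field_simp
      ring
    · rw [smul_inv_smul₀ hε.ne', add_sub_cancel]

lemma transport_le_add_of_smul_le (hd : ∀ x y, d x y ∈ Icc 0 D) (hμ : μ ∈ stdSimplex ℝ V)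
    (hν : ν ∈ stdSimplex ℝ V) (hμ' : μ' ∈ stdSimplex ℝ V) (hν' : ν' ∈ stdSimplex ℝ V) (hε : 0 ≤ ε)
    (hμμ' : (1 - ε) • μ ≤ μ') (hνν' : (1 - ε) • ν ≤ ν') :
    transport d μ' ν' ≤ transport d μ ν + ε * D := by
  have hT : 0 ≤ transport d μ ν := transport_nonneg (fun x y => (hd x y).1) μ ν
  have hle {ρ σ : V → ℝ} (hρ : ρ ∈ stdSimplex ℝ V) (hσ : σ ∈ stdSimplex ℝ V) :
      transport d ρ σ ≤ D := transport_le (fun x y => (hd x y).2) hρ hσ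
  rcases le_total 1 ε with h1 | h1
  · nlinarith [hle hμ hν, hle hμ' hν']
  obtain ⟨ρ, hρ, rfl⟩ := exists_eq_add_smul_of_smul_le hμ hμ' hε hμμ'
  obtain ⟨σ, hσ, rfl⟩ := exists_eq_add_smul_of_smul_le hν hν' hε hνν'
  calc transport d ((1 - ε) • μ + ε • ρ) ((1 - ε) • ν + ε • σ)
      ≤ (1 - ε) * transport d μ ν + ε * transport d ρ σ :=
        transport_add_smul_le d hμ hν hρ hσ (by linarith) hε (by ring)
    _ ≤ transport d μ ν + ε * D := by nlinarith [hle hρ hσ]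

lemma IsCoupling.add_le_add_one (hν : ν ∈ stdSimplex ℝ V) (hA : IsCoupling μ ν A) (x y : V) :
    μ x + ν y ≤ A x y + 1 := by
  classical
  have hrow := Finset.add_sum_erase Finset.univ (A x) (Finset.mem_univ y)
  have hmass := Finset.add_sum_erase Finset.univ ν (Finset.mem_univ y)
  have hle : ∑ v ∈ Finset.univ.erase y, A x v ≤ ∑ v ∈ Finset.univ.erase y, ν v :=
    Finset.sum_le_sum fun v _ => hA.2.2 v ▸
      Finset.single_le_sum (f := fun u => A u v) (fun u _ => (hA.1 u v).1) (Finset.mem_univ x)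
  rw [hA.2.1] at hrow
  rw [hν.2] at hmass
  linarith

/-- By the Fréchet bound, the plan `A` moves at least the mass `1 - t` from `x` to `y`. -/
lemma IsCoupling.exists_eq_add_smul_single [DecidableEq V] (hμ : μ ∈ stdSimplex ℝ V)
    (hν : ν ∈ stdSimplex ℝ V) (hxy : 1 ≤ μ x + ν y) (ht : 0 < t) (ht1 : t ≤ 1)
    (hA : IsCoupling (t • μ + (1 - t) • Pi.single x 1) (t • ν + (1 - t) • Pi.single y 1) A) :
    ∃ B, IsCoupling μ ν B ∧ A = t • B + (1 - t) • (Pi.single x (Pi.single y 1) : V → V → ℝ) := by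
  set P : V → V → ℝ := Pi.single x (Pi.single y 1) with hP
  have hPc : IsCoupling _ _ P := isCoupling_single x y
  have hν' := convex_stdSimplex ℝ V hν (single_mem_stdSimplex ℝ y) ht.le
    (sub_nonneg.2 ht1) (add_sub_cancel t 1)
  obtain ⟨B, rfl⟩ : ∃ B, A = t • B + (1 - t) • P :=
    ⟨t⁻¹ • (A - (1 - t) • P), by rw [smul_inv_smul₀ ht.ne', sub_add_cancel]⟩
  refine ⟨B, isCoupling_of_nonneg hμ (fun u v => nonneg_of_mul_nonneg_right ?_ ht) (fun u => ?_)
    fun v => ?_, rfl⟩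
  · by_cases huv : u = x ∧ v = y
    · obtain ⟨rfl, rfl⟩ := huv
      have hfrechet := hA.add_le_add_one hν' u v
      simp only [hP, Pi.add_apply, Pi.smul_apply, Pi.single_eq_same, smul_eq_mul, mul_one]
        at hfrechet
      nlinarith
    · have hPuv : P u v = 0 := by
        rcases not_and_or.1 huv with hu | hv
        · simp [hP, hu]
        · by_cases hu : u = x <;> simp [hP, hu, hv]
      simpa [hPuv] using (hA.1 u v).1
  · simpa [Finset.sum_add_distrib, ← Finset.mul_sum, hPc.2.1, ht.ne'] using hA.2.1 u
  · simpa [Finset.sum_add_distrib, ← Finset.mul_sum, hPc.2.2, ht.ne'] using hA.2.2 v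

lemma transport_add_smul_single [DecidableEq V] (d : V → V → ℝ) (hμ : μ ∈ stdSimplex ℝ V)
    (hν : ν ∈ stdSimplex ℝ V) (hxy : 1 ≤ μ x + ν y) (ht : 0 < t) (ht1 : t ≤ 1) :
    transport d (t • μ + (1 - t) • Pi.single x 1) (t • ν + (1 - t) • Pi.single y 1) =
      t * transport d μ ν + (1 - t) * d x y := by
  have hx := single_mem_stdSimplex ℝ x
  have hy := single_mem_stdSimplex ℝ y
  have h1t := sub_nonneg.2 ht1
  have htt := add_sub_cancel t 1
  apply le_antisymm
  · refine (transport_add_smul_le d hμ hν hx hy ht.le h1t htt).trans ?_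
    gcongr
    exact (transport_le_planCost d (isCoupling_single x y)).trans_eq (planCost_single d x y)
  · obtain ⟨A, hA, hcost⟩ := exists_isCoupling_planCost_eq d
      (convex_stdSimplex ℝ V hμ hx ht.le h1t htt) (convex_stdSimplex ℝ V hν hy ht.le h1t htt)
    obtain ⟨B, hB, rfl⟩ := hA.exists_eq_add_smul_single hμ hν hxy ht ht1
    rw [← hcost, planCost_add, planCost_smul, planCost_smul, planCost_single]
    gcongr
    exact transport_le_planCost d hB

end Transport

section PathDistance

variable {V : Type*} {H : SimpleGraph V} {w w' : Sym2 V → ℝ} {x y : V}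

lemma wdist_comm (H : SimpleGraph V) (w : Sym2 V → ℝ) (x y : V) :
    wdist H w x y = wdist H w y x :=
  Function.Surjective.iInf_congr (fun p : H.Path x y => p.reverse)
    (fun p => ⟨p.reverse, Subtype.ext p.1.reverse_reverse⟩)
    fun p => by simp [SimpleGraph.Path.reverse, List.map_reverse, List.sum_reverse]

lemma wdist_congr (h : EqOn w w' H.edgeSet) : wdist H w = wdist H w' := by
  funext x y
  exact iInf_congr fun p => congrArg _ (List.map_congr_left fun e he =>
    h (p.1.edges_subset_edgeSet he))

lemma exceedingEdges_congr (h : EqOn w w' H.edgeSet) :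
    exceedingEdges H w = exceedingEdges H w' := by
  ext e
  simp only [exceedingEdges, mem_ofPred_eq, wdist_congr h]
  refine exists_congr fun u => exists_congr fun v => and_congr_right fun huv => ?_
  rw [h (H.mem_edgeSet.2 huv)]

lemma exceedingEdges_subset (H : SimpleGraph V) (w : Sym2 V → ℝ) :
    exceedingEdges H w ⊆ H.edgeSet := by
  rintro _ ⟨u, v, huv, rfl, -⟩
  exact huv

lemma sum_edges_nonneg (hw : ∀ e ∈ H.edgeSet, 0 ≤ w e) (p : H.Walk x y) :
    0 ≤ (p.edges.map w).sum := by
  refine List.sum_nonneg fun a ha => ?_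
  obtain ⟨e, he, rfl⟩ := List.mem_map.1 ha
  exact hw e (p.edges_subset_edgeSet he)

lemma wdist_nonneg (hw : ∀ e ∈ H.edgeSet, 0 ≤ w e) (x y : V) : 0 ≤ wdist H w x y :=
  Real.iInf_nonneg fun p => sum_edges_nonneg hw p.1

lemma wdist_le_sum_edges (hw : ∀ e ∈ H.edgeSet, 0 ≤ w e) (p : H.Path x y) :
    wdist H w x y ≤ (p.1.edges.map w).sum :=
  ciInf_le ⟨0, by rintro _ ⟨q, rfl⟩; exact sum_edges_nonneg hw q.1⟩ p

lemma wdist_le_of_adj (hw : ∀ e ∈ H.edgeSet, 0 ≤ w e) (hxy : H.Adj x y) :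
    wdist H w x y ≤ w s(x, y) := by
  simpa [SimpleGraph.Path.singleton] using wdist_le_sum_edges hw (SimpleGraph.Path.singleton hxy)

lemma le_wdist {δ : ℝ} (hδ : 0 ≤ δ) (hw : ∀ e ∈ H.edgeSet, δ ≤ w e) (hxy : H.Adj x y) :
    δ ≤ wdist H w x y := by
  have : Nonempty (H.Path x y) := ⟨SimpleGraph.Path.singleton hxy⟩
  refine le_ciInf fun ⟨p, _⟩ => ?_
  cases p with
  | nil => exact absurd rfl hxy.ne
  | cons h q =>
    simp only [SimpleGraph.Walk.edges_cons, List.map_cons, List.sum_cons]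
    linarith [sum_edges_nonneg (fun e he => hδ.trans (hw e he)) q, hw _ (H.mem_edgeSet.2 h)]

lemma wdist_eq_of_exceedingEdges_eq_empty (hw : ∀ e ∈ H.edgeSet, 0 ≤ w e)
    (h : exceedingEdges H w = ∅) (hxy : H.Adj x y) : wdist H w x y = w s(x, y) :=
  (wdist_le_of_adj hw hxy).antisymm <| not_lt.1 fun hlt =>
    eq_empty_iff_forall_notMem.1 h s(x, y) ⟨x, y, hxy, rfl, hlt⟩

lemma wdist_pos [Finite V] (hw : ∀ e ∈ H.edgeSet, 0 < w e) (hxy : H.Adj x y) :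
    0 < wdist H w x y := by
  obtain ⟨e, he, hmin⟩ := exists_min_image H.edgeSet w (toFinite _) ⟨s(x, y), hxy⟩
  exact (hw e he).trans_le (le_wdist (hw e he).le hmin hxy)

variable [Fintype V] {η Λ : ℝ}

lemma length_edges_mul_le (hη : 0 ≤ η) (p : H.Path x y) :
    p.1.edges.length * η ≤ Fintype.card V * η := by
  rw [SimpleGraph.Walk.length_edges]
  gcongr
  exact p.2.length_lt.le

lemma wdist_le_add (hη : 0 ≤ η) (hw : ∀ e ∈ H.edgeSet, 0 ≤ w e)
    (h : ∀ e ∈ H.edgeSet, w e ≤ w' e + η) (x y : V) :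
    wdist H w x y ≤ wdist H w' x y + Fintype.card V * η := by
  rcases isEmpty_or_nonempty (H.Path x y) with hp | hp
  · simp only [wdist, Real.iInf_of_isEmpty]
    positivity
  rw [← sub_le_iff_le_add]
  refine le_ciInf fun p => sub_le_iff_le_add.2 ?_
  calc wdist H w x y ≤ (p.1.edges.map w).sum := wdist_le_sum_edges hw p
    _ ≤ (p.1.edges.map fun e => w' e + η).sum :=
        List.sum_le_sum fun e he => h e (p.1.edges_subset_edgeSet he)
    _ = (p.1.edges.map w').sum + p.1.edges.length * η := by simp [List.sum_map_add]
    _ ≤ (p.1.edges.map w').sum + Fintype.card V * η := by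
        gcongr _ + ?_
        exact length_edges_mul_le hη p

lemma wdist_le_card_mul (hΛ : 0 ≤ Λ) (hw : ∀ e ∈ H.edgeSet, w e ∈ Icc 0 Λ) (x y : V) :
    wdist H w x y ≤ Fintype.card V * Λ := by
  rcases isEmpty_or_nonempty (H.Path x y) with hp | ⟨⟨p⟩⟩
  · simp only [wdist, Real.iInf_of_isEmpty]
    positivity
  calc wdist H w x y ≤ (p.1.edges.map w).sum := wdist_le_sum_edges (fun e he => (hw e he).1) p
    _ ≤ (p.1.edges.map fun _ => Λ).sum :=
        List.sum_le_sum fun e he => (hw e (p.1.edges_subset_edgeSet he)).2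
    _ = p.1.edges.length * Λ := by simp
    _ ≤ Fintype.card V * Λ := length_edges_mul_le hΛ p

end PathDistance

section Curvature

variable {V : Type*} [Fintype V] {γ : ℝ → ℝ} {H : SimpleGraph V} {w w' : Sym2 V → ℝ} {α Λ : ℝ}
  {x y : V} {e : Sym2 V}

open Classical in
/-- The total `γ`-weight of the edges at `x`, by which the lazy random walk is normalized. -/
noncomputable def neighborWeight (γ : ℝ → ℝ) (H : SimpleGraph V) (w : Sym2 V → ℝ) (x : V) : ℝ :=
  ∑ z with H.Adj x z, γ (w s(x, z))

lemma lazyWalk_self (γ : ℝ → ℝ) (H : SimpleGraph V) (w : Sym2 V → ℝ) (α : ℝ) (x : V) :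
    lazyWalk γ H w α x x = α := if_pos rfl

lemma lazyWalk_of_adj (γ : ℝ → ℝ) (w : Sym2 V → ℝ) (α : ℝ) (hxy : H.Adj x y) :
    lazyWalk γ H w α x y = (1 - α) * (γ (w s(x, y)) / neighborWeight γ H w x) := by
  rw [lazyWalk, if_neg hxy.ne', if_pos hxy, neighborWeight]

lemma lazyWalk_of_ne_of_not_adj (γ : ℝ → ℝ) (w : Sym2 V → ℝ) (α : ℝ) (hne : y ≠ x)
    (hxy : ¬H.Adj x y) : lazyWalk γ H w α x y = 0 := by
  rw [lazyWalk, if_neg hne, if_neg hxy]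

lemma neighborWeight_congr (h : EqOn w w' H.edgeSet) (x : V) :
    neighborWeight γ H w x = neighborWeight γ H w' x :=
  Finset.sum_congr rfl fun z hz => by
    classical rw [h (H.mem_edgeSet.2 (Finset.mem_filter.1 hz).2)]

lemma lazyWalk_congr (h : EqOn w w' H.edgeSet) : lazyWalk γ H w = lazyWalk γ H w' := by
  funext α x y
  by_cases hne : y = x
  · simp only [hne, lazyWalk_self]
  by_cases hxy : H.Adj x y
  · rw [lazyWalk_of_adj _ _ _ hxy, lazyWalk_of_adj _ _ _ hxy, neighborWeight_congr h,
      h (H.mem_edgeSet.2 hxy)]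
  · rw [lazyWalk_of_ne_of_not_adj _ _ _ hne hxy, lazyWalk_of_ne_of_not_adj _ _ _ hne hxy]

lemma neighborWeight_pos (hγ : ∀ x : ℝ, 0 < x → 0 < γ x) (hw : ∀ e ∈ H.edgeSet, 0 < w e)
    (hxy : H.Adj x y) : 0 < neighborWeight γ H w x := by
  classical
  exact Finset.sum_pos (fun z hz => hγ _ (hw s(x, z) (Finset.mem_filter.1 hz).2))
    ⟨y, Finset.mem_filter.2 ⟨Finset.mem_univ y, hxy⟩⟩

lemma lazyWalk_affine [DecidableEq V] (γ : ℝ → ℝ) (H : SimpleGraph V) (w : Sym2 V → ℝ)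
    (t α : ℝ) (x : V) :
    lazyWalk γ H w (t * α + (1 - t)) x = t • lazyWalk γ H w α x + (1 - t) • Pi.single x 1 := by
  funext y
  by_cases hne : y = x
  · simp [hne, lazyWalk_self]
  by_cases hxy : H.Adj x y
  · simp only [lazyWalk_of_adj _ _ _ hxy, Pi.add_apply, Pi.smul_apply, Pi.single_eq_of_ne hne,
      smul_eq_mul]
    ring
  · simp [lazyWalk_of_ne_of_not_adj _ _ _ hne hxy, hne]

lemma lazyWalk_zero_mem_stdSimplex (hγ : ∀ x : ℝ, 0 < x → 0 < γ x)
    (hw : ∀ e ∈ H.edgeSet, 0 < w e) (hxy : H.Adj x y) :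
    lazyWalk γ H w 0 x ∈ stdSimplex ℝ V := by
  classical
  have hsum := neighborWeight_pos hγ hw hxy
  have hwalk (z : V) : lazyWalk γ H w 0 x z =
      if H.Adj x z then γ (w s(x, z)) / neighborWeight γ H w x else 0 := by
    split_ifs with hz
    · rw [lazyWalk_of_adj _ _ _ hz, sub_zero, one_mul]
    · rcases eq_or_ne z x with rfl | hne
      · exact lazyWalk_self _ _ _ _ _
      · exact lazyWalk_of_ne_of_not_adj _ _ _ hne hz
  refine ⟨fun z => ?_, ?_⟩
  · rw [hwalk]
    split_ifs with hz
    · exact div_nonneg (hγ _ (hw _ hz)).le hsum.le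
    · exact le_rfl
  · simp only [hwalk, ← Finset.sum_filter, ← Finset.sum_div]
    exact div_self hsum.ne'

lemma lazyWalk_mem_stdSimplex (hγ : ∀ x : ℝ, 0 < x → 0 < γ x) (hw : ∀ e ∈ H.edgeSet, 0 < w e)
    (hxy : H.Adj x y) (hα : α ∈ Icc 0 1) : lazyWalk γ H w α x ∈ stdSimplex ℝ V := by
  classical
  have h := lazyWalk_affine γ H w (1 - α) 0 x
  rw [mul_zero, zero_add, sub_sub_cancel] at h
  rw [h]
  exact convex_stdSimplex ℝ V (lazyWalk_zero_mem_stdSimplex hγ hw hxy)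
    (single_mem_stdSimplex ℝ x) (sub_nonneg.2 hα.2) hα.1 (sub_add_cancel 1 α)

lemma alphaCurvature_congr (h : EqOn w w' H.edgeSet) :
    alphaCurvature γ H w = alphaCurvature γ H w' := by
  funext α x y
  rw [alphaCurvature, alphaCurvature, wdist_congr h, lazyWalk_congr h]

lemma alphaCurvature_comm (γ : ℝ → ℝ) (H : SimpleGraph V) (w : Sym2 V → ℝ) (α : ℝ) (x y : V) :
    alphaCurvature γ H w α x y = alphaCurvature γ H w α y x := by
  have hswap : Function.swap (wdist H w) = wdist H w := funext₂ fun u v => wdist_comm H w v u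
  rw [alphaCurvature, alphaCurvature, ← transport_swap, hswap, wdist_comm H w x y]

lemma alphaCurvature_div (hγ : ∀ x : ℝ, 0 < x → 0 < γ x) (hw : ∀ e ∈ H.edgeSet, 0 < w e)
    (hxy : H.Adj x y) (hα : α ∈ Ico (1 / 2) 1) :
    alphaCurvature γ H w α x y / (1 - α) = 2 * alphaCurvature γ H w (1 / 2) x y := by
  classical
  have hpos : 0 < 1 - α := sub_pos.2 hα.2
  have hhalf : (1 / 2 : ℝ) ∈ Icc 0 1 := by norm_num
  have htransport := transport_add_smul_single (wdist H w) (x := x) (y := y)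
    (lazyWalk_mem_stdSimplex hγ hw hxy hhalf) (lazyWalk_mem_stdSimplex hγ hw hxy.symm hhalf)
    (by norm_num [lazyWalk_self]) (t := 2 * (1 - α)) (by linarith) (by linarith [hα.1])
  rw [← lazyWalk_affine, ← lazyWalk_affine,
    show 2 * (1 - α) * (1 / 2) + (1 - 2 * (1 - α)) = α by ring] at htransport
  have hd := wdist_pos hw hxy
  rw [alphaCurvature, alphaCurvature, htransport]
  field_simp
  ring

/-- The Ollivier-Lin-Lu-Yau curvature of an edge, computed from the half-lazy random walk; see
`hasRicciCurvature_iff`. -/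
noncomputable def edgeCurvature (γ : ℝ → ℝ) (H : SimpleGraph V) (w : Sym2 V → ℝ) : Sym2 V → ℝ :=
  Sym2.lift ⟨fun x y => 2 * alphaCurvature γ H w (1 / 2) x y,
    fun x y => congrArg (2 * ·) (alphaCurvature_comm γ H w (1 / 2) x y)⟩

lemma hasRicciCurvature_iff (hγ : ∀ x : ℝ, 0 < x → 0 < γ x) (hw : ∀ e ∈ H.edgeSet, 0 < w e)
    (hxy : H.Adj x y) {k : ℝ} :
    HasRicciCurvature γ H w x y k ↔ k = edgeCurvature γ H w s(x, y) := by
  have hlim : HasRicciCurvature γ H w x y (edgeCurvature γ H w s(x, y)) := by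
    refine tendsto_const_nhds.congr' ?_
    filter_upwards [Ico_mem_nhdsLT (show (1 / 2 : ℝ) < 1 by norm_num)] with α hα
    exact (alphaCurvature_div hγ hw hxy hα).symm
  exact ⟨fun hk => tendsto_nhds_unique hk hlim, fun hk => hk ▸ hlim⟩

/-- The vector field of the unnormalized Ricci flow on `H`, extended by zero to the pairs that are
not edges. -/
noncomputable def ricciField (γ : ℝ → ℝ) (H : SimpleGraph V) (w : Sym2 V → ℝ) : Sym2 V → ℝ :=
  H.edgeSet.indicator fun e => -edgeCurvature γ H w e * w e

lemma ricciField_congr (h : EqOn w w' H.edgeSet) : ricciField γ H w = ricciField γ H w' := by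
  refine indicator_congr fun e he => ?_
  simp only [edgeCurvature, alphaCurvature_congr h, h he]

/-- The transportation distance between the half-lazy random walks at `x` and `y`. -/
noncomputable def halfTransport (γ : ℝ → ℝ) (H : SimpleGraph V) (w : Sym2 V → ℝ) (x y : V) : ℝ :=
  transport (wdist H w) (lazyWalk γ H w (1 / 2) x) (lazyWalk γ H w (1 / 2) y)

lemma ricciField_of_adj (γ : ℝ → ℝ) (w : Sym2 V → ℝ) (hxy : H.Adj x y) :
    ricciField γ H w s(x, y) =
      -2 * w s(x, y) + 2 * (halfTransport γ H w x y * w s(x, y) / wdist H w x y) := by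
  rw [ricciField, indicator_of_mem (H.mem_edgeSet.2 hxy), edgeCurvature, Sym2.lift_mk]
  simp only [alphaCurvature, halfTransport]
  ring

lemma halfTransport_mem_Icc (hγ : ∀ x : ℝ, 0 < x → 0 < γ x) (hΛ : 0 ≤ Λ)
    (hw : ∀ e ∈ H.edgeSet, w e ∈ Ioc 0 Λ) (hxy : H.Adj x y) :
    halfTransport γ H w x y ∈ Icc 0 (Fintype.card V * Λ) := by
  have hpos : ∀ e ∈ H.edgeSet, 0 < w e := fun e he => (hw e he).1
  have hhalf : (1 / 2 : ℝ) ∈ Icc 0 1 := by norm_num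
  exact ⟨transport_nonneg (wdist_nonneg fun e he => (hpos e he).le) _ _,
    transport_le (wdist_le_card_mul hΛ fun e he => Ioc_subset_Icc_self (hw e he))
      (lazyWalk_mem_stdSimplex hγ hpos hxy hhalf) (lazyWalk_mem_stdSimplex hγ hpos hxy.symm hhalf)⟩

lemma neg_two_mul_le_ricciField (hw : ∀ e ∈ H.edgeSet, 0 ≤ w e) (he : e ∈ H.edgeSet) :
    -2 * w e ≤ ricciField γ H w e := by
  induction e using Sym2.ind with | _ x y
  have hnonneg : 0 ≤ halfTransport γ H w x y * w s(x, y) / wdist H w x y :=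
    div_nonneg (mul_nonneg (transport_nonneg (wdist_nonneg hw) _ _) (hw _ he))
      (wdist_nonneg hw x y)
  rw [ricciField_of_adj γ w he]
  linarith

lemma ricciField_le (hγ : ∀ x : ℝ, 0 < x → 0 < γ x) (hΛ : 0 ≤ Λ)
    (hw : ∀ e ∈ H.edgeSet, w e ∈ Ioc 0 Λ) (hno : exceedingEdges H w = ∅) (he : e ∈ H.edgeSet) :
    ricciField γ H w e ≤ 2 * Fintype.card V * Λ := by
  induction e using Sym2.ind with | _ x y
  have hwxy := (hw _ he).1
  rw [ricciField_of_adj γ w he,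
    wdist_eq_of_exceedingEdges_eq_empty (fun e he => (hw e he).1.le) hno he,
    mul_div_cancel_right₀ _ hwxy.ne']
  linarith [(halfTransport_mem_Icc hγ hΛ hw he).2]

end Curvature

section Lipschitz

variable {X : Type*} [PseudoMetricSpace X] {s : Set X} {f g : X → ℝ} {K L A B δ : ℝ≥0}

lemma lipschitzOnWith_mul_of_abs_le (hf : LipschitzOnWith K f s) (hg : LipschitzOnWith L g s)
    (hA : ∀ x ∈ s, |f x| ≤ A) (hB : ∀ x ∈ s, |g x| ≤ B) :
    LipschitzOnWith (A * L + K * B) (fun x => f x * g x) s := by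
  refine LipschitzOnWith.of_dist_le_mul fun x hx y hy => ?_
  have hfxy := hf.dist_le_mul x hx y hy
  have hgxy := hg.dist_le_mul x hx y hy
  rw [Real.dist_eq] at hfxy hgxy ⊢
  calc |f x * g x - f y * g y| = |f x * (g x - g y) + (f x - f y) * g y| := by ring_nf
    _ ≤ |f x| * |g x - g y| + |f x - f y| * |g y| := by
        simpa only [abs_mul] using abs_add_le (f x * (g x - g y)) ((f x - f y) * g y)
    _ ≤ A * (L * dist x y) + K * dist x y * B := by
        gcongr
        exacts [hA x hx, hB y hy]
    _ = (A * L + K * B : ℝ≥0) * dist x y := by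
        push_cast
        ring

lemma lipschitzOnWith_inv_of_le (hf : LipschitzOnWith K f s) (hδ : 0 < δ)
    (hle : ∀ x ∈ s, δ ≤ f x) : LipschitzOnWith (K / (δ * δ)) (fun x => (f x)⁻¹) s := by
  refine LipschitzOnWith.of_dist_le_mul fun x hx y hy => ?_
  have hfx : 0 < f x := (NNReal.coe_pos.2 hδ).trans_le (hle x hx)
  have hfy : 0 < f y := (NNReal.coe_pos.2 hδ).trans_le (hle y hy)
  have hfxy := hf.dist_le_mul x hx y hy
  rw [dist_inv_inv₀ hfx.ne' hfy.ne', Real.norm_of_nonneg hfx.le, Real.norm_of_nonneg hfy.le]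
  push_cast
  rw [div_mul_eq_mul_div]
  gcongr
  exacts [hle x hx, hle y hy]

lemma lipschitzOnWith_div_of_abs_le (hf : LipschitzOnWith K f s) (hg : LipschitzOnWith L g s)
    (hδ : 0 < δ) (hA : ∀ x ∈ s, |f x| ≤ A) (hle : ∀ x ∈ s, δ ≤ g x) :
    LipschitzOnWith (A * (L / (δ * δ)) + K * δ⁻¹) (fun x => f x / g x) s := by
  simp only [div_eq_mul_inv (f _)]
  refine lipschitzOnWith_mul_of_abs_le hf (lipschitzOnWith_inv_of_le hg hδ hle) hA fun x hx => ?_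
  have hδ' := NNReal.coe_pos.2 hδ
  rw [abs_inv, abs_of_pos (hδ'.trans_le (hle x hx)), NNReal.coe_inv]
  exact inv_anti₀ hδ' (hle x hx)

lemma exists_abs_sub_le_mul_of_isCompact (hs : IsCompact s) (hf : LipschitzOnWith K f s)
    (hpos : ∀ x ∈ s, 0 < f x) :
    ∃ c : ℝ≥0, ∀ x ∈ s, ∀ y ∈ s, |f x - f y| ≤ c * dist x y * f y := by
  rcases s.eq_empty_or_nonempty with rfl | hne
  · exact ⟨0, fun x hx => hx.elim⟩
  obtain ⟨z, hz, hmin⟩ := hs.exists_isMinOn hne hf.continuousOn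
  have hfz := hpos z hz
  refine ⟨K / ⟨f z, hfz.le⟩, fun x hx y hy => ?_⟩
  calc |f x - f y| ≤ K * dist x y := hf.dist_le_mul x hx y hy
    _ = K / f z * dist x y * f z := by field_simp
    _ ≤ K / f z * dist x y * f y := by
        gcongr
        exact hmin hy

end Lipschitz

section LipschitzField

variable {V : Type*} [Fintype V] {γ : ℝ → ℝ} {H : SimpleGraph V} {w w' : Sym2 V → ℝ} {x y : V}

lemma neighborWeight_le_mul {η : ℝ}
    (h : ∀ e ∈ H.edgeSet, γ (w' e) ≤ (1 + η) * γ (w e)) (x : V) :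
    neighborWeight γ H w' x ≤ (1 + η) * neighborWeight γ H w x := by
  rw [neighborWeight, neighborWeight, Finset.mul_sum]
  classical exact Finset.sum_le_sum fun z hz => h s(x, z) (Finset.mem_filter.1 hz).2

lemma smul_lazyWalk_le {η α : ℝ} (hγ : ∀ x : ℝ, 0 < x → 0 < γ x)
    (hw : ∀ e ∈ H.edgeSet, 0 < w e) (hw' : ∀ e ∈ H.edgeSet, 0 < w' e) (hη : 0 ≤ η)
    (h : ∀ e ∈ H.edgeSet, |γ (w' e) - γ (w e)| ≤ η * γ (w e)) (hα : α ∈ Icc 0 1) (x : V) :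
    (1 - 2 * η) • lazyWalk γ H w α x ≤ lazyWalk γ H w' α x := by
  intro z
  rw [Pi.smul_apply, smul_eq_mul]
  rcases eq_or_ne z x with rfl | hne
  · rw [lazyWalk_self, lazyWalk_self]
    nlinarith [mul_nonneg hη hα.1]
  by_cases hxz : H.Adj x z
  swap
  · simp only [lazyWalk_of_ne_of_not_adj _ _ _ hne hxz, mul_zero, le_refl]
  rw [lazyWalk_of_adj _ _ _ hxz, lazyWalk_of_adj _ _ _ hxz, mul_left_comm]
  refine mul_le_mul_of_nonneg_left ?_ (sub_nonneg.2 hα.2)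
  have hN := neighborWeight_pos hγ hw hxz
  have hN' := neighborWeight_pos hγ hw' hxz
  have hg := hγ _ (hw s(x, z) hxz)
  have hg' : (1 - η) * γ (w s(x, z)) ≤ γ (w' s(x, z)) := by linarith [(abs_le.1 (h s(x, z) hxz)).1]
  have hNN' := neighborWeight_le_mul (fun e he => by linarith [(abs_le.1 (h e he)).2]) x
    (γ := γ) (H := H) (w := w) (w' := w') (η := η)
  rcases le_total (1 - 2 * η) 0 with hneg | hpos
  · exact (mul_nonpos_of_nonpos_of_nonneg hneg (div_pos hg hN).le).trans
      (div_pos (hγ _ (hw' s(x, z) hxz)) hN').le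
  rw [← mul_div_assoc, div_le_div_iff₀ hN hN']
  calc (1 - 2 * η) * γ (w s(x, z)) * neighborWeight γ H w' x
      ≤ (1 - 2 * η) * γ (w s(x, z)) * ((1 + η) * neighborWeight γ H w x) := by gcongr
    _ ≤ (1 - η) * γ (w s(x, z)) * neighborWeight γ H w x := by
        nlinarith [mul_pos hg hN, mul_nonneg (sq_nonneg η) (mul_pos hg hN).le]
    _ ≤ γ (w' s(x, z)) * neighborWeight γ H w x := by gcongr

lemma halfTransport_le_add {ε η Λ : ℝ} (hγ : ∀ x : ℝ, 0 < x → 0 < γ x) (hΛ : 0 ≤ Λ)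
    (hε : 0 ≤ ε) (hη : 0 ≤ η) (hw : ∀ e ∈ H.edgeSet, w e ∈ Ioc 0 Λ)
    (hw' : ∀ e ∈ H.edgeSet, 0 < w' e)
    (hγww' : ∀ e ∈ H.edgeSet, |γ (w e) - γ (w' e)| ≤ ε * γ (w' e))
    (hww' : ∀ e ∈ H.edgeSet, w e ≤ w' e + η) (hxy : H.Adj x y) :
    halfTransport γ H w x y ≤
      halfTransport γ H w' x y + Fintype.card V * η + 2 * ε * (Fintype.card V * Λ) := by
  have hpos : ∀ e ∈ H.edgeSet, 0 < w e := fun e he => (hw e he).1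
  have hnonneg : ∀ e ∈ H.edgeSet, 0 ≤ w e := fun e he => (hw e he).1.le
  have hhalf : (1 / 2 : ℝ) ∈ Icc 0 1 := by norm_num
  have hμ {x y : V} (hxy : H.Adj x y) := lazyWalk_mem_stdSimplex hγ hpos hxy hhalf
  have hμ' {x y : V} (hxy : H.Adj x y) := lazyWalk_mem_stdSimplex hγ hw' hxy hhalf
  have hwalk (x : V) := smul_lazyWalk_le hγ hw' hpos hε hγww' hhalf x
  calc halfTransport γ H w x y
      ≤ transport (wdist H w) (lazyWalk γ H w' (1 / 2) x) (lazyWalk γ H w' (1 / 2) y) +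
          2 * ε * (Fintype.card V * Λ) :=
        transport_le_add_of_smul_le (fun u v => ⟨wdist_nonneg hnonneg u v,
            wdist_le_card_mul hΛ (fun e he => Ioc_subset_Icc_self (hw e he)) u v⟩)
          (hμ' hxy) (hμ' hxy.symm) (hμ hxy) (hμ hxy.symm) (by positivity) (hwalk x) (hwalk y)
    _ ≤ _ := by
        gcongr
        exact transport_le_add (wdist_le_add hη hnonneg hww') (hμ' hxy) (hμ' hxy.symm)

variable {δ M : ℝ≥0}

lemma le_add_dist (w w' : Sym2 V → ℝ) (e : Sym2 V) : w e ≤ w' e + dist w w' := by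
  linarith [(abs_le.1 (dist_le_pi_dist w w' e)).2]

lemma lipschitzOnWith_wdist (H : SimpleGraph V) (x y : V) :
    LipschitzOnWith (Fintype.card V) (fun w => wdist H w x y) (H.edgeSet.pi fun _ => Ici 0) :=
  LipschitzOnWith.of_le_add_mul _ fun w hw w' _ =>
    wdist_le_add dist_nonneg hw (fun e _ => le_add_dist w w' e) x y

lemma exists_lipschitzOnWith_halfTransport (hγ : ∀ x : ℝ, 0 < x → 0 < γ x) {C : ℝ≥0}
    (hγlip : LipschitzOnWith C γ (Icc δ M)) (hδ : 0 < δ) (hxy : H.Adj x y) :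
    ∃ K, LipschitzOnWith K (fun w => halfTransport γ H w x y)
      (H.edgeSet.pi fun _ => Icc (δ : ℝ) M) := by
  have hδ' := NNReal.coe_pos.2 hδ
  obtain ⟨c, hc⟩ := exists_abs_sub_le_mul_of_isCompact isCompact_Icc hγlip
    fun u hu => hγ u (hδ'.trans_le hu.1)
  refine ⟨Fintype.card V + 2 * c * (Fintype.card V * M),
    LipschitzOnWith.of_le_add_mul _ fun w hw w' hw' => ?_⟩
  have hpos' : ∀ e ∈ H.edgeSet, 0 < w' e := fun e he => hδ'.trans_le (hw' e he).1
  have hclose : ∀ e ∈ H.edgeSet, |γ (w e) - γ (w' e)| ≤ c * dist w w' * γ (w' e) := by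
    intro e he
    refine (hc _ (hw e he) _ (hw' e he)).trans ?_
    have := hγ _ (hpos' e he)
    gcongr
    exact dist_le_pi_dist w w' e
  refine (halfTransport_le_add hγ M.coe_nonneg (by positivity) dist_nonneg
    (fun e he => ⟨hδ'.trans_le (hw e he).1, (hw e he).2⟩) hpos' hclose
    (fun e _ => le_add_dist w w' e) hxy).trans_eq ?_
  push_cast
  ring

lemma exists_lipschitzOnWith_ricciField_apply (hγ : ∀ x : ℝ, 0 < x → 0 < γ x) {C : ℝ≥0}
    (hγlip : LipschitzOnWith C γ (Icc δ M)) (hδ : 0 < δ) (H : SimpleGraph V) (e : Sym2 V) :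
    ∃ K, LipschitzOnWith K (fun w => ricciField γ H w e)
      (H.edgeSet.pi fun _ => Icc (δ : ℝ) M) := by
  by_cases he : e ∈ H.edgeSet
  swap
  · refine ⟨0, LipschitzOnWith.of_dist_le_mul fun w _ w' _ => ?_⟩
    simp only [ricciField, indicator_of_notMem he, dist_self, NNReal.coe_zero, zero_mul, le_refl]
  induction e using Sym2.ind with | _ x y
  have hδ' := NNReal.coe_pos.2 hδ
  have hpos {w : Sym2 V → ℝ} (hw : w ∈ H.edgeSet.pi fun _ => Icc (δ : ℝ) M) :
      ∀ e ∈ H.edgeSet, w e ∈ Ioc 0 (M : ℝ) := fun e he => Icc_subset_Ioc_left hδ' (hw e he)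
  have habs {w : Sym2 V → ℝ} (hw : w ∈ H.edgeSet.pi fun _ => Icc (δ : ℝ) M) :
      |w s(x, y)| ≤ M := (abs_of_pos (hpos hw _ he).1).trans_le (hpos hw _ he).2
  have htransport {w : Sym2 V → ℝ} (hw : w ∈ H.edgeSet.pi fun _ => Icc (δ : ℝ) M) :
      |halfTransport γ H w x y| ≤ (Fintype.card V * M : ℝ≥0) := by
    have h := halfTransport_mem_Icc hγ M.coe_nonneg (hpos hw) he
    simpa only [abs_of_nonneg h.1, NNReal.coe_mul, NNReal.coe_natCast] using h.2
  have heval : LipschitzOnWith 1 (fun w : Sym2 V → ℝ => w s(x, y))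
      (H.edgeSet.pi fun _ => Icc (δ : ℝ) M) := (LipschitzWith.eval s(x, y)).lipschitzOnWith
  have hwdist := (lipschitzOnWith_wdist H x y).mono
    fun w (hw : w ∈ H.edgeSet.pi fun _ => Icc (δ : ℝ) M) e he => hδ'.le.trans (hw e he).1
  obtain ⟨K, hK⟩ := exists_lipschitzOnWith_halfTransport hγ hγlip hδ he
  have hratio := lipschitzOnWith_div_of_abs_le (A := Fintype.card V * M * M)
    (lipschitzOnWith_mul_of_abs_le hK heval (fun _ => htransport) fun _ => habs) hwdist hδ
    (fun w hw => by
      rw [abs_mul, NNReal.coe_mul]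
      exact mul_le_mul (htransport hw) (habs hw) (abs_nonneg _) (NNReal.coe_nonneg _))
    fun w hw => le_wdist hδ'.le (fun e he => (hw e he).1) he
  simp only [ricciField_of_adj γ _ he]
  exact ⟨_, ((lipschitzWith_smul (-2 : ℝ)).comp_lipschitzOnWith heval).add
    ((lipschitzWith_smul (2 : ℝ)).comp_lipschitzOnWith hratio)⟩

lemma exists_lipschitzOnWith_ricciField (hγ : ∀ x : ℝ, 0 < x → 0 < γ x) {C : ℝ≥0}
    (hγlip : LipschitzOnWith C γ (Icc δ M)) (hδ : 0 < δ) (H : SimpleGraph V) :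
    ∃ K, LipschitzOnWith K (ricciField γ H) (H.edgeSet.pi fun _ => Icc (δ : ℝ) M) := by
  choose K hK using exists_lipschitzOnWith_ricciField_apply hγ hγlip hδ H
  exact ⟨∑ e, K e, LipschitzOnWith.of_dist_le_mul fun w hw w' hw' =>
    (dist_pi_le_iff (by positivity)).2 fun e => ((hK e).dist_le_mul w hw w' hw').trans <| by
      gcongr
      exact Finset.single_le_sum (fun _ _ => zero_le) (Finset.mem_univ e)⟩

end LipschitzField

section Differential

variable {a b : ℝ}

lemma exists_first_exit {E : Type*} [TopologicalSpace E] {f : ℝ → E} {U : Set E} (hab : a ≤ b)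
    (hf : ContinuousOn f (Icc a b)) (hU : IsOpen U) :
    ∃ c ∈ Icc a b, MapsTo f (Ico a c) U ∧ (f c ∈ U → c = b) := by
  by_cases hall : MapsTo f (Icc a b) U
  · exact ⟨b, right_mem_Icc.2 hab, hall.mono_left Ico_subset_Icc_self, fun _ => rfl⟩
  have hcomp : IsCompact (Icc a b ∩ f ⁻¹' Uᶜ) :=
    isCompact_Icc.of_isClosed_subset
      (hf.preimage_isClosed_of_isClosed isClosed_Icc hU.isClosed_compl) inter_subset_left
  obtain ⟨t, ht, htU⟩ : ∃ t ∈ Icc a b, f t ∉ U := by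
    simpa only [MapsTo, not_forall, exists_prop] using hall
  obtain ⟨c, hc, hleast⟩ := hcomp.exists_isLeast ⟨t, ht, htU⟩
  exact ⟨c, hc.1, fun t ht => by_contra fun htU => ht.2.not_ge
    (hleast ⟨⟨ht.1, ht.2.le.trans hc.1.2⟩, htU⟩), fun hcU => absurd hcU hc.2⟩

lemma mul_exp_le_of_mul_le_deriv {f f' : ℝ → ℝ} {k : ℝ} (hab : a ≤ b)
    (hf : ContinuousOn f (Icc a b)) (hf' : ∀ t ∈ Ico a b, HasDerivWithinAt f (f' t) (Ici t) t)
    (hk : ∀ t ∈ Ico a b, k * f t ≤ f' t) : f a * Real.exp (k * (b - a)) ≤ f b := by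
  have hgronwall := le_gronwallBound_of_liminf_deriv_right_le (f := -f) (f' := -f') (K := k)
    (ε := 0) hf.neg (fun t ht r hr => (hf' t ht).neg.liminf_right_slope_le hr) le_rfl
    (fun t ht => by
      simp only [Pi.neg_apply]
      linarith [hk t ht]) b (right_mem_Icc.2 hab)
  simp only [gronwallBound_ε0, Pi.neg_apply, neg_mul] at hgronwall
  exact neg_le_neg_iff.1 hgronwall

lemma norm_le_mul_exp_of_norm_deriv_le {E : Type*} [NormedAddCommGroup E] [NormedSpace ℝ E]
    {f f' : ℝ → E} {k : ℝ} (hab : a ≤ b) (hf : ContinuousOn f (Icc a b))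
    (hf' : ∀ t ∈ Ico a b, HasDerivWithinAt f (f' t) (Ici t) t)
    (hk : ∀ t ∈ Ico a b, ‖f' t‖ ≤ k * ‖f t‖) : ‖f b‖ ≤ ‖f a‖ * Real.exp (k * (b - a)) := by
  rw [← gronwallBound_ε0]
  exact norm_le_gronwallBound_of_norm_deriv_right_le hf hf' le_rfl
    (fun t ht => by simpa only [add_zero] using hk t ht) b (right_mem_Icc.2 hab)

lemma lipschitzWith_projIcc_comp {ι : Type*} [Fintype ι] {lo hi : ℝ} (h : lo ≤ hi) :
    LipschitzWith 1 fun (w : ι → ℝ) i => (projIcc lo hi h (w i) : ℝ) :=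
  LipschitzWith.of_dist_le_mul fun w w' => by
    rw [NNReal.coe_one, one_mul]
    refine (dist_pi_le_iff dist_nonneg).2 fun i => ?_
    simpa only [NNReal.coe_one, one_mul, Subtype.dist_eq] using
      ((LipschitzWith.projIcc h).dist_le_mul (w i) (w' i)).trans
        (mul_le_mul_of_nonneg_left (dist_le_pi_dist w w' i) zero_le_one)

lemma exists_hasDerivWithinAt_projIcc {ι : Type*} [Fintype ι] {F : (ι → ℝ) → ι → ℝ} {K : ℝ≥0}
    {lo hi : ℝ} (h : lo ≤ hi) (hF : LipschitzOnWith K F (univ.pi fun _ => Icc lo hi))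
    (x₀ : ι → ℝ) (hab : a ≤ b) :
    ∃ Z : ℝ → ι → ℝ, Z a = x₀ ∧ ∀ t ∈ Icc a b,
      HasDerivWithinAt Z (F fun i => projIcc lo hi h (Z t i)) (Icc a b) t := by
  have hmem (w : ι → ℝ) : (fun i => (projIcc lo hi h (w i) : ℝ)) ∈ univ.pi fun _ => Icc lo hi :=
    fun i _ => (projIcc lo hi h (w i)).2
  have hlip : LipschitzWith (K * 1) fun w : ι → ℝ => F fun i => projIcc lo hi h (w i) :=
    lipschitzOnWith_univ.1 <|
      hF.comp (lipschitzWith_projIcc_comp h).lipschitzOnWith fun w _ => hmem w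
  obtain ⟨L, hL⟩ := (isCompact_univ_pi fun _ => isCompact_Icc).exists_bound_of_continuousOn
    hF.continuousOn
  have hL0 : 0 ≤ L := (norm_nonneg _).trans (hL _ (hmem x₀))
  have hpicard : IsPicardLindelof (fun _ w => F fun i => projIcc lo hi h (w i))
      (⟨a, left_mem_Icc.2 hab⟩ : Icc a b) x₀
      (L.toNNReal * (b - a).toNNReal) 0 L.toNNReal (K * 1) := by
    refine IsPicardLindelof.of_time_independent (fun w _ => ?_) hlip.lipschitzOnWith ?_
    · rw [Real.coe_toNNReal L hL0]
      exact hL _ (hmem w)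
    · simp [hab]
  exact hpicard.exists_eq_forall_mem_Icc_hasDerivWithinAt₀

end Differential

section Compactness

variable {V : Type*} [Fintype V] {γ : ℝ → ℝ}

lemma exists_subset_Icc_of_isCompact {C : Set ℝ} (hC : IsCompact C) (hpos : C ⊆ Ioi 0) :
    ∃ δ M : ℝ, 0 < δ ∧ δ < M ∧ C ⊆ Icc δ M := by
  rcases C.eq_empty_or_nonempty with rfl | hne
  · exact ⟨1, 2, one_pos, one_lt_two, empty_subset _⟩
  refine ⟨sInf C, sSup C + 1, hpos (hC.sInf_mem hne), ?_, ?_⟩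
  · linarith [Real.sInf_le_sSup C hC.bddBelow hC.bddAbove]
  · exact hC.isBounded.subset_Icc_sInf_sSup.trans (Icc_subset_Icc_right (by linarith))

lemma exists_lipschitzOnWith_ricciField_of_isCompact (hγ : ∀ x : ℝ, 0 < x → 0 < γ x)
    (hγlip : ∀ δ M : ℝ, 0 < δ → δ < M → ∃ C : ℝ≥0, LipschitzOnWith C γ (Icc δ M))
    {H : SimpleGraph V} {C : Set (Sym2 V → ℝ)} (hC : IsCompact C)
    (hpos : C ⊆ H.edgeSet.pi fun _ => Ioi 0) : ∃ K, LipschitzOnWith K (ricciField γ H) C := by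
  obtain ⟨δ, M, hδ, hδM, hsub⟩ := exists_subset_Icc_of_isCompact
    ((toFinite H.edgeSet).isCompact_biUnion fun e _ => hC.image (continuous_apply e))
    (iUnion₂_subset fun e he => image_subset_iff.2 fun w hw => hpos hw e he)
  obtain ⟨L, hL⟩ := hγlip δ M hδ hδM
  obtain ⟨K, hK⟩ := exists_lipschitzOnWith_ricciField hγ (δ := ⟨δ, hδ.le⟩)
    (M := ⟨M, (hδ.trans hδM).le⟩) hL hδ H
  exact ⟨K, hK.mono fun w hw e he => hsub (mem_biUnion he ⟨w, hw, rfl⟩)⟩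

end Compactness

section Solutions

variable {V : Type*} [Fintype V] {γ : ℝ → ℝ} {H : SimpleGraph V} {X Y : ℝ → Sym2 V → ℝ}
  {w w₀ : Sym2 V → ℝ} {e : Sym2 V} {I J : Set ℝ} {s t b : ℝ}

lemma le_norm_indicator {ι : Type*} [Fintype ι] {S : Set ι} (w : ι → ℝ) {i : ι}
    (hi : i ∈ S) : w i ≤ ‖S.indicator w‖ := by
  simpa only [indicator_of_mem hi] using
    (le_abs_self _).trans (norm_le_pi_norm (S.indicator w) i)

lemma norm_ricciField_le (hγ : ∀ x : ℝ, 0 < x → 0 < γ x) (hw : ∀ e ∈ H.edgeSet, 0 < w e)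
    (hno : exceedingEdges H w = ∅) :
    ‖ricciField γ H w‖ ≤ (2 + 2 * Fintype.card V) * ‖H.edgeSet.indicator w‖ := by
  refine (pi_norm_le_iff_of_nonneg (by positivity)).2 fun e => ?_
  by_cases he : e ∈ H.edgeSet
  swap
  · rw [ricciField, indicator_of_notMem he, norm_zero]
    positivity
  have hlower := neg_two_mul_le_ricciField (γ := γ) (fun e he => (hw e he).le) he
  have hupper := ricciField_le hγ (norm_nonneg _)
    (fun e he => ⟨hw e he, le_norm_indicator w he⟩) hno he
  have hcard : 0 ≤ 2 * Fintype.card V * ‖H.edgeSet.indicator w‖ := by positivity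
  rw [Real.norm_eq_abs, abs_le]
  constructor <;> linarith [le_norm_indicator w he, hw e he]

lemma hasDerivWithinAt_indicator_iff (hγ : ∀ x : ℝ, 0 < x → 0 < γ x)
    (hpos : ∀ e ∈ H.edgeSet, 0 < X t e) :
    HasDerivWithinAt (fun τ => H.edgeSet.indicator (X τ)) (ricciField γ H (X t)) I t ↔
      ∀ x y, H.Adj x y → ∃ k, HasRicciCurvature γ H (X t) x y k ∧
        HasDerivWithinAt (fun τ => X τ s(x, y)) (-k * X t s(x, y)) I t := by
  rw [hasDerivWithinAt_pi]
  constructor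
  · intro h x y hxy
    refine ⟨_, (hasRicciCurvature_iff hγ hpos hxy).2 rfl, ?_⟩
    simpa only [ricciField, indicator_of_mem (H.mem_edgeSet.2 hxy)] using h s(x, y)
  · intro h e
    by_cases he : e ∈ H.edgeSet
    swap
    · simpa only [ricciField, indicator_of_notMem he] using hasDerivWithinAt_const t I 0
    induction e using Sym2.ind with | _ x y
    obtain ⟨k, hk, hderiv⟩ := h x y he
    rw [(hasRicciCurvature_iff hγ hpos he).1 hk] at hderiv
    simpa only [ricciField, indicator_of_mem he] using hderiv

lemma isSolutionOn_of_hasDerivWithinAt (hγ : ∀ x : ℝ, 0 < x → 0 < γ x)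
    (hpos : ∀ t ∈ I, ∀ e ∈ H.edgeSet, 0 < X t e)
    (h : ∀ t ∈ I,
      HasDerivWithinAt (fun τ => H.edgeSet.indicator (X τ)) (ricciField γ H (X t)) I t) :
    IsSolutionOn γ H X I :=
  fun t ht => ⟨fun e he => (hpos t ht e he).le,
    (hasDerivWithinAt_indicator_iff hγ (hpos t ht)).1 (h t ht)⟩

lemma isSolutionOn_of_forall_exists_mem_nhdsWithin
    (h : ∀ t ∈ I, ∃ X J, IsSolutionOn γ H X J ∧ t ∈ J ∧ J ∈ 𝓝[I] t ∧
      ∀ τ ∈ J, EqOn (Y τ) (X τ) H.edgeSet) : IsSolutionOn γ H Y I := by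
  intro t ht
  obtain ⟨X, J, hX, htJ, hJ, hYX⟩ := h t ht
  have hYXt := hYX t htJ
  refine ⟨fun e he => (hYXt he).symm ▸ (hX t htJ).1 e he, fun x y hxy => ?_⟩
  obtain ⟨k, hk, hderiv⟩ := (hX t htJ).2 x y hxy
  refine ⟨k, by rwa [HasRicciCurvature, alphaCurvature_congr hYXt], ?_⟩
  rw [hYXt (H.mem_edgeSet.2 hxy)]
  exact (hderiv.congr_of_mem (fun τ hτ => hYX τ hτ hxy) htJ).mono_of_mem_nhdsWithin hJ

namespace IsSolutionOn

lemma mono (hX : IsSolutionOn γ H X J) (h : I ⊆ J) : IsSolutionOn γ H X I :=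
  fun t ht => ⟨(hX t (h ht)).1, fun x y hxy =>
    let ⟨k, hk, hderiv⟩ := (hX t (h ht)).2 x y hxy
    ⟨k, hk, hderiv.mono h⟩⟩

lemma congr (hX : IsSolutionOn γ H X I) (h : ∀ t ∈ I, EqOn (Y t) (X t) H.edgeSet) :
    IsSolutionOn γ H Y I :=
  isSolutionOn_of_forall_exists_mem_nhdsWithin fun _ ht => ⟨X, I, hX, ht, self_mem_nhdsWithin, h⟩

lemma continuousOn (hX : IsSolutionOn γ H X I) :
    ContinuousOn (fun t => H.edgeSet.indicator (X t)) I := by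
  refine continuousOn_pi.2 fun e => ?_
  by_cases he : e ∈ H.edgeSet
  swap
  · simpa only [indicator_of_notMem he] using continuousOn_const
  induction e using Sym2.ind with | _ x y
  intro t ht
  obtain ⟨k, -, hderiv⟩ := (hX t ht).2 x y he
  simpa only [indicator_of_mem he] using hderiv.continuousWithinAt

lemma hasDerivWithinAt (hγ : ∀ x : ℝ, 0 < x → 0 < γ x) (hX : IsSolutionOn γ H X (Icc s b))
    (ht : t ∈ Ico s b) (hpos : ∀ e ∈ H.edgeSet, 0 < X t e) :
    HasDerivWithinAt (fun τ => H.edgeSet.indicator (X τ)) (ricciField γ H (X t)) (Ici t) t :=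
  ((hasDerivWithinAt_indicator_iff hγ hpos).2 (hX t (Ico_subset_Icc_self ht)).2)
    |>.mono_of_mem_nhdsWithin (Icc_mem_nhdsGE_of_mem ht)

lemma mul_exp_le (hγ : ∀ x : ℝ, 0 < x → 0 < γ x) (hX : IsSolutionOn γ H X (Icc s t))
    (hst : s ≤ t) (hpos : ∀ τ ∈ Ico s t, ∀ e ∈ H.edgeSet, 0 < X τ e) (he : e ∈ H.edgeSet) :
    X s e * Real.exp (-2 * (t - s)) ≤ X t e := by
  have hderiv (τ : ℝ) (hτ : τ ∈ Ico s t) :=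
    hasDerivWithinAt_pi.1 (hX.hasDerivWithinAt hγ hτ (hpos τ hτ)) e
  have hcont := continuousOn_pi.1 hX.continuousOn e
  simp only [indicator_of_mem he] at hderiv hcont
  exact mul_exp_le_of_mul_le_deriv hst hcont hderiv fun τ hτ =>
    neg_two_mul_le_ricciField (fun e he => (hpos τ hτ e he).le) he

lemma norm_le_mul_exp (hγ : ∀ x : ℝ, 0 < x → 0 < γ x) (hX : IsSolutionOn γ H X (Icc s t))
    (hst : s ≤ t) (hpos : ∀ τ ∈ Ico s t, ∀ e ∈ H.edgeSet, 0 < X τ e)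
    (hno : ∀ τ ∈ Ico s t, exceedingEdges H (X τ) = ∅) :
    ‖H.edgeSet.indicator (X t)‖ ≤
      ‖H.edgeSet.indicator (X s)‖ * Real.exp ((2 + 2 * Fintype.card V) * (t - s)) :=
  norm_le_mul_exp_of_norm_deriv_le hst hX.continuousOn
    (fun τ hτ => hX.hasDerivWithinAt hγ hτ (hpos τ hτ))
    fun τ hτ => norm_ricciField_le hγ (hpos τ hτ) (hno τ hτ)

lemma pos (hγ : ∀ x : ℝ, 0 < x → 0 < γ x) (hX : IsSolutionOn γ H X (Icc s t)) (hst : s ≤ t)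
    (hs : ∀ e ∈ H.edgeSet, 0 < X s e) : ∀ e ∈ H.edgeSet, 0 < X t e := by
  have hopen : IsOpen (H.edgeSet.pi fun _ => Ioi (0 : ℝ)) :=
    isOpen_set_pi (toFinite _) fun _ _ => isOpen_Ioi
  obtain ⟨c, hc, hpos, hexit⟩ := exists_first_exit hst hX.continuousOn hopen
  have hpos' : ∀ τ ∈ Ico s c, ∀ e ∈ H.edgeSet, 0 < X τ e := fun τ hτ e he => by
    simpa only [indicator_of_mem he, mem_Ioi] using hpos hτ e he
  have hposc : ∀ e ∈ H.edgeSet, 0 < X c e := fun e he =>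
    (mul_pos (hs e he) (Real.exp_pos _)).trans_le
      ((hX.mono (Icc_subset_Icc_right hc.2)).mul_exp_le hγ hc.1 hpos' he)
  rw [← hexit fun e he => by simpa only [indicator_of_mem he, mem_Ioi] using hposc e he]
  exact hposc

lemma mem_Ioo_of_forall_exceedingEdges_eq_empty {δ R : ℝ} (hγ : ∀ x : ℝ, 0 < x → 0 < γ x)
    (hX : IsSolutionOn γ H X (Icc s t)) (hst : s ≤ t) (htb : t ≤ b)
    (hs : ∀ e ∈ H.edgeSet, 0 < X s e) (hno : ∀ τ ∈ Ico s t, exceedingEdges H (X τ) = ∅)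
    (hδ : 0 ≤ δ) (hδX : δ < X s e) (hR : ‖H.edgeSet.indicator (X s)‖ < R) (he : e ∈ H.edgeSet) :
    X t e ∈ Ioo (δ * Real.exp (-2 * (b - s)))
      (R * Real.exp ((2 + 2 * Fintype.card V) * (b - s))) := by
  have hpos (τ : ℝ) (hτ : τ ∈ Ico s t) : ∀ e ∈ H.edgeSet, 0 < X τ e :=
    (hX.mono (Icc_subset_Icc_right hτ.2.le)).pos hγ hτ.1 hs
  constructor
  · calc δ * Real.exp (-2 * (b - s)) ≤ δ * Real.exp (-2 * (t - s)) := by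
          gcongr δ * Real.exp ?_
          linarith
      _ < X s e * Real.exp (-2 * (t - s)) := by gcongr
      _ ≤ X t e := hX.mul_exp_le hγ hst hpos he
  · calc X t e ≤ ‖H.edgeSet.indicator (X t)‖ := le_norm_indicator _ he
      _ ≤ ‖H.edgeSet.indicator (X s)‖ * Real.exp ((2 + 2 * Fintype.card V) * (t - s)) :=
          hX.norm_le_mul_exp hγ hst hpos hno
      _ < R * Real.exp ((2 + 2 * Fintype.card V) * (t - s)) := by gcongr
      _ ≤ R * Real.exp ((2 + 2 * Fintype.card V) * (b - s)) := by
          have : 0 ≤ R := (norm_nonneg _).trans hR.le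
          gcongr

lemma pos_of_mem_Ico (hγ : ∀ x : ℝ, 0 < x → 0 < γ x) (hX : IsSolutionOn γ H X (Ico s b))
    (hs : ∀ e ∈ H.edgeSet, 0 < X s e) (ht : t ∈ Ico s b) : ∀ e ∈ H.edgeSet, 0 < X t e :=
  (hX.mono (Icc_subset_Ico_right ht.2)).pos hγ ht.1 hs

lemma eqOn (hγ : ∀ x : ℝ, 0 < x → 0 < γ x)
    (hγlip : ∀ δ M : ℝ, 0 < δ → δ < M → ∃ C : ℝ≥0, LipschitzOnWith C γ (Icc δ M))
    (hX : IsSolutionOn γ H X (Icc s t)) (hY : IsSolutionOn γ H Y (Icc s t)) (hst : s ≤ t)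
    (hs : ∀ e ∈ H.edgeSet, 0 < X s e) (hXY : EqOn (X s) (Y s) H.edgeSet) :
    EqOn (X t) (Y t) H.edgeSet := by
  have hposX : ∀ τ ∈ Icc s t, ∀ e ∈ H.edgeSet, 0 < X τ e := fun τ hτ =>
    (hX.mono (Icc_subset_Icc_right hτ.2)).pos hγ hτ.1 hs
  have hposY : ∀ τ ∈ Icc s t, ∀ e ∈ H.edgeSet, 0 < Y τ e := fun τ hτ =>
    (hY.mono (Icc_subset_Icc_right hτ.2)).pos hγ hτ.1 fun e he => hXY he ▸ hs e he
  have hcompact := (isCompact_Icc.image_of_continuousOn hX.continuousOn).union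
    (isCompact_Icc.image_of_continuousOn hY.continuousOn)
  obtain ⟨K, hK⟩ := exists_lipschitzOnWith_ricciField_of_isCompact hγ hγlip (H := H) hcompact <| by
    rintro _ (⟨τ, hτ, rfl⟩ | ⟨τ, hτ, rfl⟩) e he
    · simpa only [indicator_of_mem he, mem_Ioi] using hposX τ hτ e he
    · simpa only [indicator_of_mem he, mem_Ioi] using hposY τ hτ e he
  have hfield (w : Sym2 V → ℝ) : ricciField γ H w = ricciField γ H (H.edgeSet.indicator w) :=
    ricciField_congr fun e he => (indicator_of_mem he w).symm
  have heq := ODE_solution_unique_of_mem_Icc_right (v := fun _ => ricciField γ H) (fun _ _ => hK)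
    hX.continuousOn (fun τ hτ => hfield (X τ) ▸
      hX.hasDerivWithinAt hγ hτ (hposX τ (Ico_subset_Icc_self hτ)))
    (fun τ hτ => Or.inl ⟨τ, Ico_subset_Icc_self hτ, rfl⟩)
    hY.continuousOn (fun τ hτ => hfield (Y τ) ▸
      hY.hasDerivWithinAt hγ hτ (hposY τ (Ico_subset_Icc_self hτ)))
    (fun τ hτ => Or.inr ⟨τ, Ico_subset_Icc_self hτ, rfl⟩)
    (indicator_congr hXY) (right_mem_Icc.2 hst)
  exact fun e he => by simpa only [indicator_of_mem he] using congrFun heq e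

lemma eqOn_of_mem_Ico {c : ℝ} (hγ : ∀ x : ℝ, 0 < x → 0 < γ x)
    (hγlip : ∀ δ M : ℝ, 0 < δ → δ < M → ∃ C : ℝ≥0, LipschitzOnWith C γ (Icc δ M))
    (hX : IsSolutionOn γ H X (Ico s b)) (hY : IsSolutionOn γ H Y (Ico s c))
    (hs : ∀ e ∈ H.edgeSet, 0 < X s e) (hXY : EqOn (X s) (Y s) H.edgeSet)
    (hb : t ∈ Ico s b) (hc : t ∈ Ico s c) : EqOn (X t) (Y t) H.edgeSet :=
  (hX.mono (Icc_subset_Ico_right hb.2)).eqOn hγ hγlip (hY.mono (Icc_subset_Ico_right hc.2)) hb.1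
    hs hXY

end IsSolutionOn

end Solutions

section Existence

variable {V : Type*} [Fintype V] {γ : ℝ → ℝ} {H : SimpleGraph V} {w₀ : Sym2 V → ℝ} {s b lo hi : ℝ}

lemma exists_isSolutionOn_Icc (hγ : ∀ x : ℝ, 0 < x → 0 < γ x)
    (hγlip : ∀ δ M : ℝ, 0 < δ → δ < M → ∃ C : ℝ≥0, LipschitzOnWith C γ (Icc δ M))
    (hlo : 0 < lo) (hw₀ : ∀ e ∈ H.edgeSet, w₀ e ∈ Ioo lo hi) (hlohi : lo < hi) (hsb : s < b) :
    ∃ c ∈ Ioc s b, ∃ X, IsSolutionOn γ H X (Icc s c) ∧ X s = w₀ ∧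
      ((∀ e ∈ H.edgeSet, X c e ∈ Ioo lo hi) → c = b) := by
  obtain ⟨K, hK⟩ := exists_lipschitzOnWith_ricciField_of_isCompact hγ hγlip (H := H)
    (isCompact_univ_pi fun _ : Sym2 V => isCompact_Icc (a := lo) (b := hi))
    fun w hw e _ => hlo.trans_le (hw e (mem_univ e)).1
  obtain ⟨X, hXs, hX⟩ := exists_hasDerivWithinAt_projIcc hlohi.le hK w₀ hsb.le
  have hcont : ContinuousOn X (Icc s b) := fun t ht => (hX t ht).continuousWithinAt
  obtain ⟨c, hc, hbox, hexit⟩ := exists_first_exit hsb.le hcont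
    (isOpen_set_pi (toFinite H.edgeSet) fun _ _ => isOpen_Ioo (a := lo) (b := hi))
  have hsc : s < c := hc.1.lt_of_ne' fun h => hsb.ne (h ▸ hexit fun e he => by
    rw [h, hXs]
    exact hw₀ e he)
  have hclosed : MapsTo X (Icc s c) (H.edgeSet.pi fun _ => Icc lo hi) := by
    have h := hbox.closure_of_continuousOn
      (hcont.mono (by rw [closure_Ico hsc.ne]; exact Icc_subset_Icc_right hc.2))
    rwa [closure_Ico hsc.ne, closure_pi_set, closure_Ioo hlohi.ne] at h
  refine ⟨c, ⟨hsc, hc.2⟩, X, isSolutionOn_of_hasDerivWithinAt hγ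
    (fun t ht e he => hlo.trans_le (hclosed ht e he).1) fun t ht => ?_, hXs, hexit⟩
  have hfield : ricciField γ H (fun e => projIcc lo hi hlohi.le (X t e)) = ricciField γ H (X t) :=
    ricciField_congr fun e he => by simp only [projIcc_of_mem _ (hclosed ht e he)]
  refine hasDerivWithinAt_pi.2 fun e => ?_
  by_cases he : e ∈ H.edgeSet
  · simpa only [indicator_of_mem he, hfield] using hasDerivWithinAt_pi.1
      ((hX t (Icc_subset_Icc_right hc.2 ht)).mono (Icc_subset_Icc_right hc.2)) e
  · simpa only [ricciField, indicator_of_notMem he] using hasDerivWithinAt_const t _ 0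

lemma exists_isSolutionOn_Ico (hγ : ∀ x : ℝ, 0 < x → 0 < γ x)
    (hγlip : ∀ δ M : ℝ, 0 < δ → δ < M → ∃ C : ℝ≥0, LipschitzOnWith C γ (Icc δ M))
    (hw₀ : ∀ e ∈ H.edgeSet, 0 < w₀ e) (hsb : s < b) :
    ∃ c ∈ Ioc s b, ∃ X, IsSolutionOn γ H X (Ico s c) ∧ X s = w₀ ∧
      ((∀ t ∈ Ico s c, exceedingEdges H (X t) = ∅) → c = b) := by
  obtain ⟨δ, M, hδ, -, hδM⟩ := exists_subset_Icc_of_isCompact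
    ((toFinite H.edgeSet).image w₀).isCompact (image_subset_iff.2 hw₀)
  have hδw (e : Sym2 V) (he : e ∈ H.edgeSet) : δ ≤ w₀ e := (hδM (mem_image_of_mem _ he)).1
  set k : ℝ := 2 + 2 * Fintype.card V
  set R : ℝ := ‖H.edgeSet.indicator w₀‖ + δ
  have hR : 0 < R := by positivity
  have hupper : 1 ≤ Real.exp (k * (b - s)) := Real.one_le_exp (by have := hsb.le; positivity)
  have hlower : Real.exp (-2 * (b - s)) ≤ 1 := Real.exp_le_one_iff.2 (by linarith)
  -- Without an exit, a solution cannot leave the box between these two exponential bounds.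
  have hbox : ∀ e ∈ H.edgeSet,
      w₀ e ∈ Ioo (δ / 2 * Real.exp (-2 * (b - s))) (R * Real.exp (k * (b - s))) := fun e he =>
    ⟨by nlinarith [hδw e he], by nlinarith [le_norm_indicator w₀ he]⟩
  obtain ⟨c, hc, X, hX, hXs, hexit⟩ := exists_isSolutionOn_Icc hγ hγlip
    (by positivity) hbox (by nlinarith [norm_nonneg (H.edgeSet.indicator w₀)]) hsb
  have hpos : ∀ e ∈ H.edgeSet, 0 < X s e := hXs ▸ hw₀
  exact ⟨c, hc, X, hX.mono Ico_subset_Icc_self, hXs, fun hno => hexit fun e he =>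
    hX.mem_Ioo_of_forall_exceedingEdges_eq_empty hγ hc.1.le hc.2 hpos hno (by positivity)
      (hXs ▸ (half_lt_self hδ).trans_le (hδw e he)) (hXs ▸ lt_add_of_pos_right _ hδ) he⟩

lemma exists_isSolutionOn_Ici (hγ : ∀ x : ℝ, 0 < x → 0 < γ x)
    (hγlip : ∀ δ M : ℝ, 0 < δ → δ < M → ∃ C : ℝ≥0, LipschitzOnWith C γ (Icc δ M))
    (hw₀ : ∀ e ∈ H.edgeSet, 0 < w₀ e)
    (hno : ∀ b X, s < b → IsSolutionOn γ H X (Ico s b) → EqOn (X s) w₀ H.edgeSet →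
      ∀ t ∈ Ico s b, exceedingEdges H (X t) = ∅) :
    ∃ X, IsSolutionOn γ H X (Ici s) ∧ EqOn (X s) w₀ H.edgeSet := by
  have hsol (b : ℝ) (hb : s < b) : ∃ X, IsSolutionOn γ H X (Ico s b) ∧ X s = w₀ := by
    obtain ⟨c, hc, X, hX, hXs, hexit⟩ := exists_isSolutionOn_Ico hγ hγlip hw₀ hb
    obtain rfl := hexit (hno c X hc.1 hX fun e _ => congrFun hXs e)
    exact ⟨X, hX, hXs⟩
  choose! X hX hXs using hsol
  have hagree {b c t : ℝ} (hb : t ∈ Ico s b) (hc : t ∈ Ico s c) :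
      EqOn (X b t) (X c t) H.edgeSet := by
    have hsb := hb.1.trans_lt hb.2
    have hsc := hc.1.trans_lt hc.2
    exact (hX b hsb).eqOn_of_mem_Ico hγ hγlip (hX c hsc) (hXs b hsb ▸ hw₀)
      (fun e _ => by rw [hXs b hsb, hXs c hsc]) hb hc
  refine ⟨fun t => X (t + 1) t, isSolutionOn_of_forall_exists_mem_nhdsWithin fun t ht => ?_,
    fun e _ => congrFun (hXs (s + 1) (lt_add_one s)) e⟩
  have htmem : t ∈ Ico s (t + 1) := ⟨ht, lt_add_one t⟩
  refine ⟨X (t + 1), Ico s (t + 1), hX _ (htmem.1.trans_lt htmem.2), htmem, ?_,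
    fun τ hτ => hagree ⟨hτ.1, lt_add_one τ⟩ hτ⟩
  rw [← Ici_inter_Iio]
  exact inter_mem_nhdsWithin _ (Iio_mem_nhds htmem.2)

end Existence

section Infima

variable {α : Type*} [LinearOrder α] {A B : Set α} {p q : α → Prop} {s b c T T' : α}

lemma isGLB_of_forall_lt_mem_iff (hA : IsGLB A T) (hTb : T < b) (h : ∀ t < b, t ∈ A ↔ t ∈ B) :
    IsGLB B T := by
  refine ⟨fun t ht => ?_, fun u hu => ?_⟩
  · rcases lt_or_ge t b with htb | hbt
    · exact hA.1 ((h t htb).2 ht)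
    · exact hTb.le.trans hbt
  · by_contra! hTu
    obtain ⟨t, ht, htub⟩ := (isGLB_lt_iff hA).1 (lt_min hTu hTb)
    exact (hu ((h t (htub.trans_le (min_le_right _ _))).1 ht)).not_gt
      (htub.trans_le (min_le_left _ _))

lemma isGLB_sep_Ico_iff (hTb : T < b) (hTc : T < c)
    (h : ∀ t ∈ Ico s b, t ∈ Ico s c → (p t ↔ q t)) :
    IsGLB {t ∈ Ico s b | p t} T ↔ IsGLB {t ∈ Ico s c | q t} T := by
  have hmem (t : α) (ht : t < min b c) : t ∈ {t ∈ Ico s b | p t} ↔ t ∈ {t ∈ Ico s c | q t} := by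
    have htb := ht.trans_le (min_le_left _ _)
    have htc := ht.trans_le (min_le_right _ _)
    exact ⟨fun ⟨hb, hp⟩ => ⟨⟨hb.1, htc⟩, (h t hb ⟨hb.1, htc⟩).1 hp⟩,
      fun ⟨hc, hq⟩ => ⟨⟨hc.1, htb⟩, (h t ⟨hc.1, htb⟩ hc).2 hq⟩⟩
  exact ⟨fun hT => isGLB_of_forall_lt_mem_iff hT (lt_min hTb hTc) hmem,
    fun hT => isGLB_of_forall_lt_mem_iff hT (lt_min hTb hTc) fun t ht => (hmem t ht).symm⟩

variable [NoTopOrder α]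

lemma mem_Ico_of_isGLB_sep (hT : IsGLB {t ∈ Ico s b | p t} T) : T ∈ Ico s b := by
  obtain ⟨t, ht⟩ := hT.nonempty
  exact ⟨hT.2 fun t ht => ht.1.1, (hT.1 ht).trans_lt ht.1.2⟩

lemma eq_of_isGLB_sep_Ico (hT : IsGLB {t ∈ Ico s b | p t} T)
    (hT' : IsGLB {t ∈ Ico s c | q t} T') (h : ∀ t ∈ Ico s b, t ∈ Ico s c → (p t ↔ q t)) :
    T = T' := by
  have hTb := (mem_Ico_of_isGLB_sep hT).2
  have hTc := (mem_Ico_of_isGLB_sep hT').2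
  rcases le_total T T' with hle | hle
  · exact ((isGLB_sep_Ico_iff hTb (hle.trans_lt hTc) h).1 hT).unique hT'
  · exact hT.unique ((isGLB_sep_Ico_iff (hle.trans_lt hTb) hTc h).2 hT')

lemma exists_isGLB_of_isGLB_iUnion {ι : Type*} [Finite ι] {A : ι → Set α}
    (hT : IsGLB (⋃ i, A i) T) : ∃ i, IsGLB (A i) T := by
  by_contra! hnot
  have hlower (i : ι) : ∃ u, T < u ∧ u ∈ lowerBounds (A i) := by
    by_contra! h
    exact hnot i ⟨fun t ht => hT.1 (mem_iUnion_of_mem i ht), fun u hu =>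
      not_lt.1 fun hTu => h u hTu hu⟩
  choose u hTu hu using hlower
  obtain ⟨-, -, ⟨j, -⟩, -⟩ := hT.nonempty
  have : Nonempty ι := ⟨j⟩
  obtain ⟨i, hi⟩ := Finite.exists_min u
  refine (hTu i).not_ge (hT.2 fun t ht => ?_)
  obtain ⟨j, hj⟩ := mem_iUnion.1 ht
  exact (hi j).trans (hu j hj)

end Infima

section Exit

variable {V : Type*} {γ : ℝ → ℝ} {H : SimpleGraph V} {X Y : ℝ → Sym2 V → ℝ} {I : Set ℝ}
  {s b c T T' : ℝ}

lemma exitingEdges_subset : exitingEdges H X I T ⊆ H.edgeSet := fun _ he =>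
  let ⟨_, ht⟩ := IsGLB.nonempty he
  exceedingEdges_subset H _ ht.2

lemma exitingEdges_nonempty [Finite V]
    (hT : IsGLB {t ∈ I | (exceedingEdges H (X t)).Nonempty} T) :
    (exitingEdges H X I T).Nonempty := by
  have hunion : {t ∈ I | (exceedingEdges H (X t)).Nonempty} =
      ⋃ e, {t ∈ I | e ∈ exceedingEdges H (X t)} := by
    ext t
    simp only [mem_ofPred_eq, mem_iUnion, Set.Nonempty, exists_and_left]
  exact exists_isGLB_of_isGLB_iUnion (hunion ▸ hT)

lemma exitingEdges_congr (hTb : T < b) (hTc : T < c)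
    (h : ∀ t ∈ Ico s b, t ∈ Ico s c → EqOn (X t) (Y t) H.edgeSet) :
    exitingEdges H X (Ico s b) T = exitingEdges H Y (Ico s c) T :=
  ext fun _ => isGLB_sep_Ico_iff hTb hTc fun t hb hc => by rw [exceedingEdges_congr (h t hb hc)]

lemma edgeSet_deleteEdges_subset (H : SimpleGraph V) (S : Set (Sym2 V)) :
    (H.deleteEdges S).edgeSet ⊆ H.edgeSet :=
  SimpleGraph.edgeSet_mono (H.deleteEdges_le S)

lemma deleteEdges_lt_of_isSelectionRule {sel : Set (Sym2 V) → Set (Sym2 V)}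
    (hsel : IsSelectionRule sel) {S : Set (Sym2 V)} (hS : S.Nonempty) (hSH : S ⊆ H.edgeSet) :
    H.deleteEdges (sel S) < H := by
  obtain ⟨⟨e, he⟩, hsub⟩ := hsel S hS
  refine (H.deleteEdges_le _).lt_of_ne fun h => ?_
  exact disjoint_left.1 (SimpleGraph.deleteEdges_eq_self.1 h) (hSH (hsub he)) he

variable [Fintype V]

lemma not_isGLB_of_forall_exceedingEdges_eq_empty (hγ : ∀ x : ℝ, 0 < x → 0 < γ x)
    (hγlip : ∀ δ M : ℝ, 0 < δ → δ < M → ∃ C : ℝ≥0, LipschitzOnWith C γ (Icc δ M))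
    (hX : IsSolutionOn γ H X (Ici s)) (hY : IsSolutionOn γ H Y (Ico s b))
    (hs : ∀ e ∈ H.edgeSet, 0 < X s e) (hXY : EqOn (X s) (Y s) H.edgeSet)
    (hno : ∀ t, s ≤ t → exceedingEdges H (X t) = ∅) :
    ¬ IsGLB {t ∈ Ico s b | (exceedingEdges H (Y t)).Nonempty} T := fun hT => by
  obtain ⟨t, ht, hexit⟩ := hT.nonempty
  have heq := (hX.mono Ico_subset_Ici_self).eqOn_of_mem_Ico hγ hγlip hY hs hXY ht ht
  rw [← exceedingEdges_congr heq, hno t ht.1] at hexit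
  exact not_nonempty_empty hexit

lemma IsSolutionOn.exit_unique (hγ : ∀ x : ℝ, 0 < x → 0 < γ x)
    (hγlip : ∀ δ M : ℝ, 0 < δ → δ < M → ∃ C : ℝ≥0, LipschitzOnWith C γ (Icc δ M))
    (hX : IsSolutionOn γ H X (Ico s b)) (hY : IsSolutionOn γ H Y (Ico s c))
    (hs : ∀ e ∈ H.edgeSet, 0 < X s e) (hXY : EqOn (X s) (Y s) H.edgeSet)
    (hT : IsGLB {t ∈ Ico s b | (exceedingEdges H (X t)).Nonempty} T)
    (hT' : IsGLB {t ∈ Ico s c | (exceedingEdges H (Y t)).Nonempty} T') :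
    T = T' ∧ exitingEdges H X (Ico s b) T = exitingEdges H Y (Ico s c) T ∧
      ∀ t ∈ Icc s T, EqOn (X t) (Y t) H.edgeSet := by
  have heq (t : ℝ) : t ∈ Ico s b → t ∈ Ico s c → EqOn (X t) (Y t) H.edgeSet :=
    hX.eqOn_of_mem_Ico hγ hγlip hY hs hXY
  obtain rfl : T = T' := eq_of_isGLB_sep_Ico hT hT' fun t hb hc => by
    rw [exceedingEdges_congr (heq t hb hc)]
  have hTb := (mem_Ico_of_isGLB_sep hT).2
  have hTc := (mem_Ico_of_isGLB_sep hT').2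
  exact ⟨rfl, exitingEdges_congr hTb hTc heq, fun t ht =>
    heq t ⟨ht.1, ht.2.trans_lt hTb⟩ ⟨ht.1, ht.2.trans_lt hTc⟩⟩

end Exit

section Flow

variable {V : Type*} [Fintype V] {γ : ℝ → ℝ} {sel : Set (Sym2 V) → Set (Sym2 V)}
  {H : SimpleGraph V} {w₀ w₁ : Sym2 V → ℝ} {s : ℝ} {K K' : ℝ → SimpleGraph V}
  {Y Y' : ℝ → Sym2 V → ℝ}

namespace IsFlow

lemma congr (h : IsFlow γ sel H s w₀ K Y) (hK : ∀ t, s ≤ t → K' t = K t)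
    (hY : ∀ t, s ≤ t → Y' t = Y t) : IsFlow γ sel H s w₀ K' Y' := by
  induction h with
  | noExit hsol hinit hno hKH =>
    exact .noExit (hsol.congr fun t ht e _ => congrFun (hY t ht) e)
      (fun e he => by rw [hY _ le_rfl, hinit e he]) (fun t ht => by rw [hY t ht, hno t ht])
      fun t ht => (hK t ht).trans (hKH t ht)
  | exit X b T hX hinit hT hKH hYX _ ih =>
    have hsT := (mem_Ico_of_isGLB_sep hT).1
    exact .exit X b T hX hinit hT (fun t ht => (hK t ht.1).trans (hKH t ht))
      (fun t ht e he => by rw [hY t ht.1, hYX t ht e he])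
      (ih (fun t ht => hK t (hsT.trans ht)) fun t ht => hY t (hsT.trans ht))

lemma pos (hγ : ∀ x : ℝ, 0 < x → 0 < γ x) (h : IsFlow γ sel H s w₀ K Y)
    (hw₀ : ∀ e ∈ H.edgeSet, 0 < w₀ e) : ∀ t, s ≤ t → ∀ e ∈ (K t).edgeSet, 0 < Y t e := by
  induction h with
  | noExit hsol hinit _ hKH =>
    intro t ht
    rw [hKH t ht]
    exact (hsol.mono Icc_subset_Ici_self).pos hγ ht fun e he => hinit e he ▸ hw₀ e he
  | exit X b T hX hinit hT hKH hYX _ ih =>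
    have hTb := mem_Ico_of_isGLB_sep hT
    have hXpos (t : ℝ) (ht : t ∈ Ico _ b) : ∀ e ∈ _, 0 < X t e :=
      hX.pos_of_mem_Ico hγ (fun e he => hinit e he ▸ hw₀ e he) ht
    intro t ht e he
    rcases lt_or_ge t T with htT | hTt
    · rw [hKH t ⟨ht, htT⟩] at he
      rw [hYX t ⟨ht, htT⟩ e he]
      exact hXpos t ⟨ht, htT.trans hTb.2⟩ e he
    · exact ih (fun e he => hXpos T hTb e (edgeSet_deleteEdges_subset _ _ he)) t hTt e he

lemma unique (hγ : ∀ x : ℝ, 0 < x → 0 < γ x)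
    (hγlip : ∀ δ M : ℝ, 0 < δ → δ < M → ∃ C : ℝ≥0, LipschitzOnWith C γ (Icc δ M))
    (h : IsFlow γ sel H s w₀ K Y) (hw₀ : ∀ e ∈ H.edgeSet, 0 < w₀ e)
    (h' : IsFlow γ sel H s w₁ K' Y') (hw : EqOn w₀ w₁ H.edgeSet) :
    ∀ t, s ≤ t → K' t = K t ∧ EqOn (Y' t) (Y t) (K t).edgeSet := by
  induction h generalizing w₁ with
  | @noExit H s w₀ K Y hsol hinit hno hKH =>
    have hYs : ∀ e ∈ H.edgeSet, 0 < Y s e := fun e he => hinit e he ▸ hw₀ e he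
    cases h' with
    | noExit hsol' hinit' _ hKH' =>
      have heq : EqOn (Y s) (Y' s) H.edgeSet := fun e he => by rw [hinit e he, hinit' e he, hw he]
      intro t ht
      rw [hKH t ht, hKH' t ht]
      exact ⟨rfl, ((hsol.mono Icc_subset_Ici_self).eqOn hγ hγlip
        (hsol'.mono Icc_subset_Ici_self) ht hYs heq).symm⟩
    | exit X' _ _ hX' hinit' hT' =>
      have heq : EqOn (Y s) (X' s) H.edgeSet := fun e he => by rw [hinit e he, hinit' e he, hw he]
      exact (not_isGLB_of_forall_exceedingEdges_eq_empty hγ hγlip hsol hX' hYs heq hno hT').elim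
  | @exit H s w₀ K Y X b T hX hinit hT hKH hYX _ ih =>
    have hXs : ∀ e ∈ H.edgeSet, 0 < X s e := fun e he => hinit e he ▸ hw₀ e he
    cases h' with
    | noExit hsol' hinit' hno' _ =>
      have heq : EqOn (Y' s) (X s) H.edgeSet := fun e he => by rw [hinit e he, hinit' e he, hw he]
      exact (not_isGLB_of_forall_exceedingEdges_eq_empty hγ hγlip hsol' hX
        (fun e he => heq he ▸ hXs e he) heq hno' hT).elim
    | exit X' b' T' hX' hinit' hT' hKH' hYX' hrest' =>
      have hXX' : EqOn (X s) (X' s) H.edgeSet := fun e he => by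
        rw [hinit e he, hinit' e he, hw he]
      obtain ⟨rfl, hexit, heq⟩ := hX.exit_unique hγ hγlip hX' hXs hXX' hT hT'
      rw [← hexit] at hrest'
      intro t ht
      rcases lt_or_ge t T with htT | hTt
      · rw [hKH t ⟨ht, htT⟩, hKH' t ⟨ht, htT⟩]
        refine ⟨rfl, fun e he => ?_⟩
        rw [hYX t ⟨ht, htT⟩ e he, hYX' t ⟨ht, htT⟩ e he, heq t ⟨ht, htT.le⟩ he]
      · have hTb := mem_Ico_of_isGLB_sep hT
        have hsub := edgeSet_deleteEdges_subset H (sel (exitingEdges H X (Ico s b) T))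
        exact ih (fun e he => hX.pos_of_mem_Ico hγ hXs hTb e (hsub he)) hrest'
          ((heq T (right_mem_Icc.2 hTb.1)).mono hsub) t hTt

end IsFlow

lemma exists_isFlow (hγ : ∀ x : ℝ, 0 < x → 0 < γ x)
    (hγlip : ∀ δ M : ℝ, 0 < δ → δ < M → ∃ C : ℝ≥0, LipschitzOnWith C γ (Icc δ M))
    (hsel : IsSelectionRule sel) (hw₀ : ∀ e ∈ H.edgeSet, 0 < w₀ e) (s : ℝ) :
    ∃ K Y, IsFlow γ sel H s w₀ K Y := by
  induction H using WellFoundedLT.induction generalizing w₀ s with | _ H ih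
  by_cases hno : ∀ b X, s < b → IsSolutionOn γ H X (Ico s b) → EqOn (X s) w₀ H.edgeSet →
      ∀ t ∈ Ico s b, exceedingEdges H (X t) = ∅
  · obtain ⟨Y, hY, hinit⟩ := exists_isSolutionOn_Ici hγ hγlip hw₀ hno
    exact ⟨fun _ => H, Y, .noExit hY hinit (fun t ht => hno (t + 1) Y (by linarith)
      (hY.mono Ico_subset_Ici_self) hinit t ⟨ht, lt_add_one t⟩) fun _ _ => rfl⟩
  · push Not at hno
    obtain ⟨b, X, -, hX, hinit, t, ht, hexit⟩ := hno
    obtain ⟨T, hT⟩ : ∃ T, IsGLB {t ∈ Ico s b | (exceedingEdges H (X t)).Nonempty} T :=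
      ⟨_, isGLB_csInf ⟨t, ht, hexit⟩ ⟨s, fun t ht => ht.1.1⟩⟩
    have hXT := hX.pos_of_mem_Ico hγ (fun e he => hinit he ▸ hw₀ e he) (mem_Ico_of_isGLB_sep hT)
    obtain ⟨K, Y, hKY⟩ := ih _
      (deleteEdges_lt_of_isSelectionRule hsel (exitingEdges_nonempty hT) exitingEdges_subset)
      (fun e he => hXT e (edgeSet_deleteEdges_subset _ _ he)) T
    classical
    exact ⟨fun t => if t < T then H else K t, fun t => if t < T then X t else Y t,
      .exit X b T hX hinit hT (fun t ht => if_pos ht.2) (fun t ht e _ => by rw [if_pos ht.2])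
        (hKY.congr (fun t ht => if_neg ht.not_gt) fun t ht => if_neg ht.not_gt)⟩

end Flow

end RicciFlow

theorem mainTheorem2_general {V : Type*} [Fintype V] (G : SimpleGraph V)
    (γ : ℝ → ℝ) (hγpos : ∀ x : ℝ, 0 < x → 0 < γ x)
    (hγlip : ∀ δ M : ℝ, 0 < δ → δ < M → ∃ C : NNReal, LipschitzOnWith C γ (Set.Icc δ M))
    (w₀ : Sym2 V → ℝ) (hw₀ : ∀ e ∈ G.edgeSet, 0 < w₀ e) :
    (∀ sel : Set (Sym2 V) → Set (Sym2 V), RicciFlow.IsSelectionRule sel →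
      ∃ (K : ℝ → SimpleGraph V) (X : ℝ → Sym2 V → ℝ),
        RicciFlow.IsFlow γ sel G 0 w₀ K X ∧
        (∀ t, 0 ≤ t → ∀ e ∈ (K t).edgeSet, 0 < X t e) ∧
        ∀ (K' : ℝ → SimpleGraph V) (X' : ℝ → Sym2 V → ℝ),
          RicciFlow.IsFlow γ sel G 0 w₀ K' X' →
          ∀ t, 0 ≤ t → K' t = K t ∧ ∀ e ∈ (K t).edgeSet, X' t e = X t e) ∧
    ((∀ (b : ℝ) (X : ℝ → Sym2 V → ℝ), 0 < b →
        RicciFlow.IsSolutionOn γ G X (Set.Ico 0 b) → (∀ e ∈ G.edgeSet, X 0 e = w₀ e) →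
        ∀ t ∈ Set.Ico 0 b, RicciFlow.exceedingEdges G (X t) = ∅) →
      ∃ X : ℝ → Sym2 V → ℝ,
        RicciFlow.IsSolutionOn γ G X (Set.Ici 0) ∧
        (∀ e ∈ G.edgeSet, X 0 e = w₀ e) ∧
        (∀ t, 0 ≤ t → ∀ e ∈ G.edgeSet, 0 < X t e) ∧
        ∀ X' : ℝ → Sym2 V → ℝ,
          RicciFlow.IsSolutionOn γ G X' (Set.Ici 0) → (∀ e ∈ G.edgeSet, X' 0 e = w₀ e) →
          ∀ t, 0 ≤ t → ∀ e ∈ G.edgeSet, X' t e = X t e) := by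
  constructor
  · intro sel hsel
    obtain ⟨K, X, hflow⟩ := RicciFlow.exists_isFlow hγpos hγlip hsel hw₀ 0
    exact ⟨K, X, hflow, hflow.pos hγpos hw₀, fun K' X' hflow' =>
      hflow.unique hγpos hγlip hw₀ hflow' (eqOn_refl _ _)⟩
  · intro hno
    obtain ⟨X, hX, hinit⟩ := RicciFlow.exists_isSolutionOn_Ici hγpos hγlip hw₀ hno
    have hX0 : ∀ e ∈ G.edgeSet, 0 < X 0 e := fun e he => hinit he ▸ hw₀ e he
    have hX_Icc (t : ℝ) : RicciFlow.IsSolutionOn γ G X (Icc 0 t) := hX.mono Icc_subset_Ici_self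
    refine ⟨X, hX, hinit, fun t ht => (hX_Icc t).pos hγpos ht hX0, fun X' hX' hinit' t ht => ?_⟩
    have heq : EqOn (X 0) (X' 0) G.edgeSet := fun e he => (hinit he).trans (hinit' e he).symm
    exact ((hX_Icc t).eqOn hγpos hγlip (hX'.mono Icc_subset_Ici_self) ht hX0 heq).symm

theorem mainTheorem2 {V : Type*} [Fintype V] (G : SimpleGraph V) (hG : G.Connected)
    (γ : ℝ → ℝ) (hγpos : ∀ x : ℝ, 0 < x → 0 < γ x)
    (hγlip : ∀ δ M : ℝ, 0 < δ → δ < M → ∃ C : NNReal, LipschitzOnWith C γ (Set.Icc δ M))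
    (w₀ : Sym2 V → ℝ) (hw₀ : ∀ e ∈ G.edgeSet, 0 < w₀ e) :
    -- the flow in which edges meeting the exit condition are deleted
    (∀ sel : Set (Sym2 V) → Set (Sym2 V), RicciFlow.IsSelectionRule sel →
      ∃ (K : ℝ → SimpleGraph V) (X : ℝ → Sym2 V → ℝ),
        RicciFlow.IsFlow γ sel G 0 w₀ K X ∧
        (∀ t, 0 ≤ t → ∀ e ∈ (K t).edgeSet, 0 < X t e) ∧
        ∀ (K' : ℝ → SimpleGraph V) (X' : ℝ → Sym2 V → ℝ),
          RicciFlow.IsFlow γ sel G 0 w₀ K' X' →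
          ∀ t, 0 ≤ t → K' t = K t ∧ ∀ e ∈ (K t).edgeSet, X' t e = X t e) ∧
    -- the system on the fixed graph `G`, when the exit condition is never met
    ((∀ (b : ℝ) (X : ℝ → Sym2 V → ℝ), 0 < b →
        RicciFlow.IsSolutionOn γ G X (Set.Ico 0 b) → (∀ e ∈ G.edgeSet, X 0 e = w₀ e) →
        ∀ t ∈ Set.Ico 0 b, RicciFlow.exceedingEdges G (X t) = ∅) →
      ∃ X : ℝ → Sym2 V → ℝ,
        RicciFlow.IsSolutionOn γ G X (Set.Ici 0) ∧
        (∀ e ∈ G.edgeSet, X 0 e = w₀ e) ∧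
        (∀ t, 0 ≤ t → ∀ e ∈ G.edgeSet, 0 < X t e) ∧
        ∀ X' : ℝ → Sym2 V → ℝ,
          RicciFlow.IsSolutionOn γ G X' (Set.Ici 0) → (∀ e ∈ G.edgeSet, X' 0 e = w₀ e) →
          ∀ t, 0 ≤ t → ∀ e ∈ G.edgeSet, X' t e = X t e) :=
  mainTheorem2_general G γ hγpos hγlip w₀ hw₀
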